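/- For $n\ge 1$ let $\pi_n$ be a random permutation of $[n]=\{1,\dots,n\}$ (the $\pi_n$ need not be defined on a common probability space). Let $\pi_n(t)=\pi_n(\lceil nt\rceil)/n$, $t\in(0,1]$, be the permutation process, and let $d_n(t)=d_n(\lceil nt\rceil)/n$, $t\in(0,1]$, be the degree process, where $d_n(i)=\#\{j\in[n]:(i-j)(\pi_n(i)-\pi_n(j))<0\}$ is the degree of the vertex $i$ in the permutation graph of $\pi_n$. Let $\mathcal M$ be the set of Borel probability measures on $[0,1]^2$ both of whose marginals are uniform on $[0,1]$, and let $\nu_{\pi_n}\in\mathcal M$ be the permuton associated with $\pi_n$, that is, the measure with Lebesgue density $n$ on the squares $\left(\frac{i-1}{n},\frac in\right]\times\left(\frac{\pi_n(i)-1}{n},\frac{\pi_n(i)}{n}\right]$, $i\in[n]$, and $0$ elsewhere. Suppose that the finite-dimensional distributions of $(\pi_n(t))_{t\in(0,1]}$ converge weakly, as $n\to\infty$, to those of a $[0,1]$-valued process $(Z(t))_{t\in(0,1]}$. Then there is a (possibly random) measure $\mu\in\mathcal M$, defined on the same probability space as $Z$, such that 1. $\nu_{\pi_n}$ converges in distribution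 to $\mu$, that is, $\int f\,d\nu_{\pi_n}\to\int f\,d\mu$ in distribution for every continuous $f:[0,1]^2\to\mathbb R$; 2. this convergence holds jointly with that of the permutation process: for all continuous $f_1,\dots,f_m:[0,1]^2\to\mathbb R$ and all $t_1,\dots,t_k\in(0,1]$, the vector $\left(\int f_1\,d\nu_{\pi_n},\dots,\int f_m\,d\nu_{\pi_n},\pi_n(t_1),\dots,\pi_n(t_k)\right)$ converges in distribution to $\left(\int f_1\,d\mu,\dots,\int f_m\,d\mu,Z(t_1),\dots,Z(t_k)\right)$; 3. the finite-dimensional distributions of $(d_n(t))_{t\in(0,1]}$ converge weakly to those of the process $$D(t)=t+Z(t)-2F_\mu(t,Z(t)),\qquad t\in(0,1],$$ where $F_\mu(x,y)=\mu([0,x]\times[0,y])$ is the distribution function of $\mu$. -/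

import Mathlib

open MeasureTheory Filter
open scoped unitInterval Topology

noncomputable section

/-- The index `⌈n x⌉` of a point `x ∈ (0, 1]`, counted from `0`: it is the `i : Fin n` with
`x ∈ (i / n, (i + 1) / n]`.  The point `x = 0` is put into the first cell. -/
def cellIndex (n : ℕ) [NeZero n] (x : I) : Fin n :=
  ⟨⌈(n : ℝ) * (x : ℝ)⌉₊ - 1, by
    have hn : 0 < n := Nat.pos_of_ne_zero (NeZero.ne n)
    have h : ⌈(n : ℝ) * (x : ℝ)⌉₊ ≤ n :=
      Nat.ceil_le.mpr (mul_le_of_le_one_right (Nat.cast_nonneg n) x.2.2)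
    omega⟩

/-- The permutation graph of `τ`: the vertices `i` and `j` are adjacent if and only if they form an
inversion, `(i - j) (τ i - τ j) < 0`. -/
def permGraph {n : ℕ} (τ : Equiv.Perm (Fin n)) : SimpleGraph (Fin n) where
  Adj i j := (((i : ℕ) : ℤ) - ((j : ℕ) : ℤ)) * (((τ i : ℕ) : ℤ) - ((τ j : ℕ) : ℤ)) < 0
  symm := ⟨fun i j h => by
    have e : (((j : ℕ) : ℤ) - ((i : ℕ) : ℤ)) * (((τ j : ℕ) : ℤ) - ((τ i : ℕ) : ℤ)) =
      (((i : ℕ) : ℤ) - ((j : ℕ) : ℤ)) * (((τ i : ℕ) : ℤ) - ((τ j : ℕ) : ℤ)) := by ring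
    rw [e]; exact h⟩
  loopless := ⟨fun i h => by simp at h⟩

instance {n : ℕ} (τ : Equiv.Perm (Fin n)) : DecidableRel (permGraph τ).Adj :=
  fun i j => inferInstanceAs (Decidable
    ((((i : ℕ) : ℤ) - ((j : ℕ) : ℤ)) * (((τ i : ℕ) : ℤ) - ((τ j : ℕ) : ℤ)) < 0))

/-- The rescaled permutation `τ(⌈n t⌉) / n`.  The label of `i : Fin n` in `{1, …, n}` is `i + 1`. -/
def permProcess {n : ℕ} [NeZero n] (τ : Equiv.Perm (Fin n)) (t : I) : I :=
  ⟨(((τ (cellIndex n t) : ℕ) : ℝ) + 1) / (n : ℝ), by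
    have hn : (0 : ℝ) < n := Nat.cast_pos.mpr (Nat.pos_of_ne_zero (NeZero.ne n))
    have h : (((τ (cellIndex n t) : ℕ) : ℝ) + 1) ≤ n := by
      exact_mod_cast (τ (cellIndex n t)).isLt
    exact ⟨by positivity, (div_le_one hn).mpr h⟩⟩

/-- The rescaled degree `d(⌈n t⌉) / n` in the permutation graph of `τ`. -/
def degreeProcess {n : ℕ} [NeZero n] (τ : Equiv.Perm (Fin n)) (t : I) : ℝ :=
  ((permGraph τ).degree (cellIndex n t) : ℝ) / (n : ℝ)

/-- The permuton associated with `τ`: the measure on the unit square whose density with respect to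
Lebesgue measure is `n` on the squares of side `1 / n` in position `(i, τ i)`, and `0` elsewhere. -/
def permutonOf {n : ℕ} [NeZero n] (τ : Equiv.Perm (Fin n)) : Measure (I × I) :=
  (volume : Measure (I × I)).withDensity fun p =>
    if τ (cellIndex n p.1) = cellIndex n p.2 then (n : ENNReal) else 0

/-- Permutons: (probability) measures on the unit square with uniform marginals. -/
structure IsPermuton (μ : Measure (I × I)) : Prop where
  map_fst : μ.map Prod.fst = (volume : Measure I)
  map_snd : μ.map Prod.snd = (volume : Measure I)

/-- The distribution function `F_μ(x, y) = μ([0, x] × [0, y])` of a measure on the unit square. -/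
def distFun (μ : Measure (I × I)) (x y : I) : ℝ :=
  μ.real (Set.Iic x ×ˢ Set.Iic y)

/-- Convergence of the finite-dimensional distributions of the processes `X n`, indexed by `T`, to
those of `Y`.  Each process may live on its own probability space. -/
def TendstoFDD {T E Ω : Type*} {Ω' : ℕ+ → Type*}
    [TopologicalSpace E] [SecondCountableTopology E] [MeasurableSpace E] [BorelSpace E]
    [∀ n, MeasurableSpace (Ω' n)] [MeasurableSpace Ω]
    (X : ∀ n, T → Ω' n → E) (Y : T → Ω → E)
    (P' : ∀ n, Measure (Ω' n)) [∀ n, IsProbabilityMeasure (P' n)]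
    (P : Measure Ω) [IsProbabilityMeasure P] : Prop :=
  ∀ (k : ℕ) (t : Fin k → T),
    TendstoInDistribution (fun n ω i => X n (t i) ω) atTop (fun ω i => Y (t i) ω) P' P

/-- Convergence in distribution of the random measures `ν n` on the unit square to the random
measure `μ`: for every continuous `f`, the random variables `∫ f dν n` converge in distribution
to `∫ f dμ`. -/
def TendstoRandomMeasure {Ω : Type*} {Ω' : ℕ+ → Type*}
    [∀ n, MeasurableSpace (Ω' n)] [MeasurableSpace Ω]
    (ν : ∀ n, Ω' n → Measure (I × I)) (μ : Ω → Measure (I × I))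
    (P' : ∀ n, Measure (Ω' n)) [∀ n, IsProbabilityMeasure (P' n)]
    (P : Measure Ω) [IsProbabilityMeasure P] : Prop :=
  ∀ f : C(I × I, ℝ),
    TendstoInDistribution (fun n ω => ∫ p, f p ∂(ν n ω)) atTop (fun ω => ∫ p, f p ∂(μ ω)) P' P

/-- Joint convergence in distribution of random measures `ν n` on the unit square and processes
`X n` to the random measure `μ` and the process `Y`, in the sense of all finite collections of
test functions and of times. -/
def TendstoJointly {T E Ω : Type*} {Ω' : ℕ+ → Type*}
    [TopologicalSpace E] [SecondCountableTopology E] [MeasurableSpace E] [BorelSpace E]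
    [∀ n, MeasurableSpace (Ω' n)] [MeasurableSpace Ω]
    (ν : ∀ n, Ω' n → Measure (I × I)) (X : ∀ n, T → Ω' n → E)
    (μ : Ω → Measure (I × I)) (Y : T → Ω → E)
    (P' : ∀ n, Measure (Ω' n)) [∀ n, IsProbabilityMeasure (P' n)]
    (P : Measure Ω) [IsProbabilityMeasure P] : Prop :=
  ∀ (m k : ℕ) (f : Fin m → C(I × I, ℝ)) (t : Fin k → T),
    TendstoInDistribution
      (fun n ω => ((fun j => ∫ p, f j p ∂(ν n ω) : Fin m → ℝ), (fun i => X n (t i) ω : Fin k → E)))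
      atTop
      (fun ω => ((fun j => ∫ p, f j p ∂(μ ω) : Fin m → ℝ), (fun i => Y (t i) ω : Fin k → E)))
      P' P

end

/-! The occupation measure of a process `Y` is the image of Lebesgue measure under `s ↦ (s, Y s)`.
For the rescaled permutation it is the uniform measure on a graph, and it differs from the permuton
only by moves of size at most `1 / n` in the second coordinate. Everything thus reduces to a limit
theorem for occupation measures, jointly with values at fixed times.

That theorem is a method of moments. By Fubini, the expectation of a product of `m` averages against
the occupation measure, times a function of `k` values of the process, is an integral over times
`s₁, …, s_m` of an expectation involving only `m + k` values. For fixed times this converges by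
hypothesis, and dominated convergence handles the integral (`tendsto_integral_averageProduct`). The
averages stay in a compact box, so Stone–Weierstrass upgrades moments to convergence in distribution
(`tendstoInDistribution_averageVector`).

The paths of `Z` need not be measurable, so the limit `μ` cannot be defined path by path. On path
space with the law `Q` of `Z`, however, the joint law of the path and its value at `s` is measurable
in `s`, because its finite-dimensional marginals are limits of measurable families. Mixing over `s`
and disintegrating over the path gives a kernel that satisfies the Fubini identity by construction
(`exists_isOccupationKernel`). Its marginals are almost surely uniform, being limits of quantities
that converge to constants.

For the degrees, counting inversions gives `d(i) = i + π(i) - 2 #{j ≤ i, π(j) ≤ π(i)}`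
(`degree_permGraph_add`), so the degree process is `t + π_n(t) - 2 F(t, π_n(t))` up to `O(1 / n)`.
The indicator in the value variable is replaced by a continuous ramp of width `ε`. This costs at
most `ε` in the integral, before the limit because a permutation takes each value once, and after it
because the second marginal of `μ` is uniform. -/

/-! ### Occupation kernels for processes without measurable paths -/

section LimitKernel

open ProbabilityTheory
open scoped NNReal

/-- A pointwise weak limit of measurable families of probability measures is measurable. -/
theorem measurable_of_tendsto_probabilityMeasure {T E ι : Type*} [MeasurableSpace T]
    [TopologicalSpace E] [MeasurableSpace E] [BorelSpace E] [HasOuterApproxClosed E]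
    {l : Filter ι} [l.NeBot] [l.IsCountablyGenerated]
    {ν : ι → T → ProbabilityMeasure E} {ν' : T → ProbabilityMeasure E}
    (hν : ∀ n, Measurable fun s => (ν n s : Measure E))
    (h : ∀ s, Tendsto (fun n => ν n s) l (𝓝 (ν' s))) :
    Measurable fun s => (ν' s : Measure E) := by
  refine Measurable.measure_of_isPiSystem_of_isProbabilityMeasure
    (BorelSpace.measurable_eq.trans borel_eq_generateFrom_isClosed) isPiSystem_isClosed
    fun F hF => ?_
  have hF : IsClosed F := hF
  have key (g : BoundedContinuousFunction E ℝ≥0) :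
      Measurable fun s => ∫⁻ x, g x ∂(ν' s : Measure E) := by
    refine measurable_of_tendsto_metrizable' l
      (f := fun n s => ∫⁻ x, g x ∂(ν n s : Measure E)) (fun n => ?_) ?_
    · exact (Measure.measurable_lintegral (by fun_prop)).comp (hν n)
    · rw [tendsto_pi_nhds]
      intro s
      exact (ProbabilityMeasure.tendsto_iff_forall_lintegral_tendsto.1 (h s)) g
  -- The mass of a closed set is the limit of the integrals of continuous functions approximating
  -- its indicator.
  refine measurable_of_tendsto_metrizable' atTop
    (f := fun k s => ∫⁻ x, hF.apprSeq k x ∂(ν' s : Measure E)) (fun k => key _) ?_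
  rw [tendsto_pi_nhds]
  intro s
  exact HasOuterApproxClosed.tendsto_lintegral_apprSeq hF _

variable {T X : Type*} [MeasurableSpace T] [MeasurableSpace X]

/-- The joint law of a path and of its value at time `s` depends measurably on `s` as soon as all
joint laws of finitely many values and the value at time `s` do. -/
theorem measurable_map_path_prodMk {Q : Measure (T → X)} [IsProbabilityMeasure Q]
    (h : ∀ J : Finset T, Measurable fun s => Q.map fun z => (J.restrict z, z s)) :
    Measurable fun s => Q.map fun z => (z, z s) := by
  have hm (s : T) : Measurable fun z : T → X => (z, z s) := by fun_prop
  have _ (s : T) : IsProbabilityMeasure (Q.map fun z => (z, z s)) :=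
    Measure.isProbabilityMeasure_map (hm s).aemeasurable
  refine Measurable.measure_of_isPiSystem_of_isProbabilityMeasure
    (S := Set.image2 (· ×ˢ ·) (measurableCylinders fun _ : T => X) {B | MeasurableSet B})
    ?_ ?_ ?_
  · refine (generateFrom_eq_prod generateFrom_measurableCylinders
      MeasurableSpace.generateFrom_measurableSet ?_ isCountablySpanning_measurableSet).symm
    exact ⟨fun _ => Set.univ, fun _ => univ_mem_measurableCylinders _, Set.iUnion_const _⟩
  · exact isPiSystem_measurableCylinders.prod MeasurableSpace.isPiSystem_measurableSet
  · rintro _ ⟨A, hA, B, hB, rfl⟩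
    have hB : MeasurableSet B := hB
    obtain ⟨J, S, hS, rfl⟩ := (mem_measurableCylinders A).1 hA
    convert (Measure.measurable_coe (hS.prod hB)).comp (h J) using 1
    funext s
    rw [Function.comp_apply, Measure.map_apply (hm s) ((MeasurableSet.cylinder J hS).prod hB),
      Measure.map_apply (by fun_prop) (hS.prod hB)]
    rfl

/-- A kernel `μ` is the occupation kernel of the process `Y` if `μ ω` plays the role of the image
of `lam` under `s ↦ (s, Y s ω)`, in a sense that requires no measurability of the paths of `Y`. -/
def IsOccupationKernel {Ω : Type*} [MeasurableSpace Ω] (lam : Measure T) (Y : T → Ω → X)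
    (P : Measure Ω) (μ : Kernel Ω (T × X)) : Prop :=
  ∀ F : Ω × (T × X) → ℝ, Measurable F → (∃ C, ∀ q, |F q| ≤ C) →
    ∫ ω, ∫ p, F (ω, p) ∂(μ ω) ∂P = ∫ s, ∫ ω, F (ω, (s, Y s ω)) ∂P ∂lam

/-- Mixing the joint laws of path and value over `lam` gives a law `ρ` of path, time and value; `μ`
is its conditional law of time and value given the path. -/
theorem exists_isOccupationKernel [StandardBorelSpace T] [StandardBorelSpace X] [Nonempty T]
    [Nonempty X] (lam : Measure T) [IsProbabilityMeasure lam]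
    {Q : Measure (T → X)} [IsProbabilityMeasure Q]
    (h : Measurable fun s => Q.map fun z => (z, z s)) :
    ∃ μ : Kernel (T → X) (T × X), IsMarkovKernel μ ∧
      IsOccupationKernel lam (fun s z => z s) Q μ := by
  have hm (s : T) : Measurable fun z : T → X => (z, z s) := by fun_prop
  let κ : Kernel T ((T → X) × X) := ⟨_, h⟩
  have hκ (s : T) : κ s = Q.map fun z => (z, z s) := rfl
  have _ : IsMarkovKernel κ := ⟨fun s => by
    rw [hκ]; exact Measure.isProbabilityMeasure_map (hm s).aemeasurable⟩
  let φ : T × ((T → X) × X) → (T → X) × (T × X) := fun p => (p.2.1, (p.1, p.2.2))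
  have hφ : Measurable φ := by fun_prop
  let ρ := (lam ⊗ₘ κ).map φ
  have _ : IsProbabilityMeasure ρ := Measure.isProbabilityMeasure_map hφ.aemeasurable
  -- Each `κ s` has first marginal `Q`, hence so does the mixture; this is what allows `ρ` to be
  -- disintegrated over `Q`.
  have hfst : ρ.fst = Q := by
    ext A hA
    have hA' : MeasurableSet (φ ⁻¹' (Prod.fst ⁻¹' A)) := hφ (measurable_fst hA)
    rw [Measure.fst_apply hA, Measure.map_apply hφ (measurable_fst hA),
      Measure.compProd_apply hA']
    have (s : T) : κ s (Prod.mk s ⁻¹' (φ ⁻¹' (Prod.fst ⁻¹' A))) = Q A := by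
      rw [hκ, Measure.map_apply (hm s) (measurable_prodMk_left hA')]
      rfl
    simp [this]
  have hρ : Q ⊗ₘ ρ.condKernel = ρ := by
    conv_rhs => rw [← ρ.disintegrate ρ.condKernel, hfst]
  refine ⟨ρ.condKernel, inferInstance, fun F hF ⟨C, hC⟩ => ?_⟩
  have hFi (m : Measure ((T → X) × (T × X))) [IsProbabilityMeasure m] : Integrable F m :=
    Integrable.of_bound hF.aestronglyMeasurable C (ae_of_all _ hC)
  calc ∫ z, ∫ p, F (z, p) ∂(ρ.condKernel z) ∂Q = ∫ q, F q ∂(Q ⊗ₘ ρ.condKernel) :=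
        (Measure.integral_compProd (hFi _)).symm
    _ = ∫ q, F q ∂ρ := by rw [hρ]
    _ = ∫ p, F (φ p) ∂(lam ⊗ₘ κ) := integral_map hφ.aemeasurable hF.aestronglyMeasurable
    _ = ∫ s, ∫ x, F (φ (s, x)) ∂(κ s) ∂lam := by
        refine Measure.integral_compProd (Integrable.of_bound
          (hF.comp hφ).aestronglyMeasurable C (ae_of_all _ fun p => hC _))
    _ = ∫ s, ∫ z, F (z, (s, z s)) ∂Q ∂lam := by
        congr 1 with s
        have hs : Measurable fun x => F (φ (s, x)) := by fun_prop
        rw [hκ, integral_map (hm s).aemeasurable hs.aestronglyMeasurable]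

end LimitKernel

/-! ### Convergence of mixed moments of occupation averages -/

section Moments

open ProbabilityTheory

variable {T X Ω : Type*} [MeasurableSpace T] [MeasurableSpace X] [MeasurableSpace Ω]

/-- The product of the averages of the functions `f j` against `ν`, times `g`. -/
noncomputable def averageProduct {k m : ℕ} (f : Fin m → T × X × (Fin k → X) → ℝ)
    (g : (Fin k → X) → ℝ) (ν : Measure (T × X)) (x : Fin k → X) : ℝ :=
  (∏ j, ∫ p, f j (p.1, p.2, x) ∂ν) * g x

theorem averageProduct_succ {k m : ℕ} (f : Fin (m + 1) → T × X × (Fin k → X) → ℝ)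
    (g : (Fin k → X) → ℝ) (ν : Measure (T × X)) (x : Fin k → X) :
    averageProduct f g ν x =
      ∫ p, f 0 (p.1, p.2, x) * averageProduct (fun j => f j.succ) g ν x ∂ν := by
  rw [integral_mul_const, averageProduct, averageProduct, Fin.prod_univ_succ, mul_assoc]

theorem averageProduct_cons {k m : ℕ} (f : Fin (m + 1) → T × X × (Fin k → X) → ℝ)
    (g : (Fin k → X) → ℝ) (ν : Measure (T × X)) (s : T) (x : Fin (k + 1) → X) :
    averageProduct (fun j p => f (Fin.succ j) (p.1, p.2.1, Fin.tail p.2.2))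
        (fun x => f 0 (s, x 0, Fin.tail x) * g (Fin.tail x)) ν x =
      f 0 (s, x 0, Fin.tail x) * averageProduct (fun j => f j.succ) g ν (Fin.tail x) := by
  simp only [averageProduct]
  ring

variable [TopologicalSpace X]

/-- Bounded measurable functions of a time, a value at that time and `k` further values that are
continuous in the values. -/
structure IsTestFunction {k : ℕ} (f : T × X × (Fin k → X) → ℝ) : Prop where
  measurable : Measurable f
  continuous : ∀ s, Continuous fun q => f (s, q)
  bounded : ∃ C, ∀ p, |f p| ≤ C

theorem IsTestFunction.comp_tail {k : ℕ} {f : T × X × (Fin k → X) → ℝ} (hf : IsTestFunction f) :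
    IsTestFunction fun p : T × X × (Fin (k + 1) → X) => f (p.1, p.2.1, Fin.tail p.2.2) where
  measurable := hf.measurable.comp (by unfold Fin.tail; fun_prop)
  continuous s := (hf.continuous s).comp (by unfold Fin.tail; fun_prop)
  bounded := hf.bounded.imp fun _ h p => h _

theorem exists_bound_averageProduct {k m : ℕ} {f : Fin m → T × X × (Fin k → X) → ℝ}
    (hf : ∀ j, IsTestFunction (f j)) {g : (Fin k → X) → ℝ} (hg : ∃ C, ∀ x, |g x| ≤ C) :
    ∃ C, 0 ≤ C ∧ ∀ (ν : Measure (T × X)) [IsProbabilityMeasure ν] (x : Fin k → X),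
      |averageProduct f g ν x| ≤ C := by
  choose C hC using fun j => (hf j).bounded
  obtain ⟨D, hD⟩ := hg
  refine ⟨(∏ j, |C j|) * |D|, by positivity, fun ν _ x => ?_⟩
  rw [averageProduct, abs_mul, Finset.abs_prod]
  refine mul_le_mul (Finset.prod_le_prod (fun _ _ => abs_nonneg _) fun j _ => ?_)
    ((hD x).trans (le_abs_self _)) (abs_nonneg _) (by positivity)
  rw [← Real.norm_eq_abs]
  refine (norm_integral_le_of_norm_le_const (C := |C j|)
    (ae_of_all _ fun p => (hC j _).trans (le_abs_self _))).trans ?_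
  simp

theorem IsTestFunction.measurable_integral {k : ℕ} {f : T × X × (Fin k → X) → ℝ}
    (hf : IsTestFunction f) {x : Ω → Fin k → X} (hx : Measurable x) (μ : Kernel Ω (T × X))
    [IsMarkovKernel μ] : Measurable fun ω => ∫ p, f (p.1, p.2, x ω) ∂(μ ω) := by
  have h : Measurable fun q : Ω × (T × X) => f (q.2.1, q.2.2, x q.1) :=
    hf.measurable.comp (by fun_prop)
  exact (h.stronglyMeasurable.integral_kernel_prod_right' (κ := μ)).measurable

theorem measurable_averageProduct {k m : ℕ} {f : Fin m → T × X × (Fin k → X) → ℝ}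
    (hf : ∀ j, IsTestFunction (f j)) {g : (Fin k → X) → ℝ} (hg : Measurable g)
    {x : Ω → Fin k → X} (hx : Measurable x) (μ : Kernel Ω (T × X)) [IsMarkovKernel μ] :
    Measurable fun ω => averageProduct f g (μ ω) (x ω) :=
  (Finset.measurable_prod _ fun j _ => (hf j).measurable_integral hx μ).mul (hg.comp hx)

/-- The defining identity is applied to one average, with the remaining ones kept in the integrand
as functions of `ω`. This trades the average for an integral over a new time `s`, put in front of
`t`; the factor `f 0` is absorbed into the function of the fixed values. -/
theorem IsOccupationKernel.integral_averageProduct {lam : Measure T} {Y : T → Ω → X}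
    {P : Measure Ω} {μ : Kernel Ω (T × X)} [IsMarkovKernel μ]
    (hμ : IsOccupationKernel lam Y P μ) (hY : ∀ s, Measurable (Y s)) {k m : ℕ}
    {f : Fin (m + 1) → T × X × (Fin k → X) → ℝ} (hf : ∀ j, IsTestFunction (f j))
    {g : (Fin k → X) → ℝ} (hg : Measurable g) (hgb : ∃ C, ∀ x, |g x| ≤ C) (t : Fin k → T) :
    ∫ ω, averageProduct f g (μ ω) (fun i => Y (t i) ω) ∂P =
      ∫ s, ∫ ω, averageProduct (fun j p => f (Fin.succ j) (p.1, p.2.1, Fin.tail p.2.2))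
        (fun x => f 0 (s, x 0, Fin.tail x) * g (Fin.tail x)) (μ ω)
        (fun i => Y (Fin.cons (α := fun _ => T) s t i) ω) ∂P ∂lam := by
  have hx : Measurable fun ω i => Y (t i) ω := by fun_prop
  have hR := measurable_averageProduct (fun j : Fin m => hf j.succ) hg hx μ
  obtain ⟨C, hC0, hC⟩ := exists_bound_averageProduct (fun j : Fin m => hf j.succ) hgb
  obtain ⟨D, hD⟩ := (hf 0).bounded
  simp_rw [averageProduct_cons, averageProduct_succ f]
  refine (hμ (fun q => f 0 (q.2.1, q.2.2, fun i => Y (t i) q.1) *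
    averageProduct (fun j => f j.succ) g (μ q.1) (fun i => Y (t i) q.1)) ?_ ?_).trans rfl
  · exact ((hf 0).measurable.comp (by fun_prop)).mul (hR.comp measurable_fst)
  · refine ⟨|D| * C, fun q => ?_⟩
    rw [abs_mul]
    exact mul_le_mul ((hD _).trans (le_abs_self _)) (hC _ _) (abs_nonneg _) (abs_nonneg _)

variable [CompactSpace X] [SecondCountableTopology X] [BorelSpace X]

theorem Continuous.exists_abs_le {E : Type*} [TopologicalSpace E] [CompactSpace E] {g : E → ℝ}
    (hg : Continuous g) : ∃ C, ∀ x, |g x| ≤ C := by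
  obtain ⟨C, hC⟩ := isCompact_univ.exists_bound_of_continuousOn hg.continuousOn
  exact ⟨C, fun x => hC x trivial⟩

variable {Ω' : ℕ+ → Type*} [∀ n, MeasurableSpace (Ω' n)]
  {P' : ∀ n, Measure (Ω' n)} [∀ n, IsProbabilityMeasure (P' n)]
  {P : Measure Ω} [IsProbabilityMeasure P]

theorem TendstoFDD.tendsto_integral {S : Type*} {Y : ∀ n, S → Ω' n → X} {Z : S → Ω → X}
    (h : TendstoFDD Y Z P' P) {k : ℕ} (t : Fin k → S)
    {g : (Fin k → X) → ℝ} (hg : Continuous g) :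
    Tendsto (fun n => ∫ ω, g (fun i => Y n (t i) ω) ∂(P' n)) atTop
      (𝓝 (∫ ω, g (fun i => Z (t i) ω) ∂P)) := by
  have h1 := (ProbabilityMeasure.tendsto_iff_forall_integral_tendsto.1 (h k t).tendsto)
    (BoundedContinuousFunction.mkOfCompact ⟨g, hg⟩)
  convert h1 using 2 with n
  · exact (integral_map ((h k t).forall_aemeasurable n)
      hg.measurable.aestronglyMeasurable).symm
  · exact (integral_map (h k t).aemeasurable_limit
      hg.measurable.aestronglyMeasurable).symm

variable {lam : Measure T} [IsProbabilityMeasure lam]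
  {Y : ∀ n, T → Ω' n → X} {Z : T → Ω → X}
  {ν : ∀ n, Kernel (Ω' n) (T × X)} [∀ n, IsMarkovKernel (ν n)]
  {μ : Kernel Ω (T × X)} [IsMarkovKernel μ]

/-- Induction on the number of averages. Each step removes one average and adds one time, so `k`,
`t`, `f` and `g` must vary; with no averages left, the claim is convergence of the
finite-dimensional distributions. -/
theorem tendsto_integral_averageProduct (hY : ∀ n, Measurable (Function.uncurry (Y n)))
    (hZ : ∀ s, Measurable (Z s)) (hν : ∀ n, IsOccupationKernel lam (Y n) (P' n) (ν n))
    (hμ : IsOccupationKernel lam Z P μ) (h : TendstoFDD Y Z P' P) :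
    ∀ {m k : ℕ} (t : Fin k → T) {f : Fin m → T × X × (Fin k → X) → ℝ}
      (_ : ∀ j, IsTestFunction (f j)) {g : (Fin k → X) → ℝ} (_ : Continuous g),
    Tendsto (fun n => ∫ ω, averageProduct f g (ν n ω) (fun i => Y n (t i) ω) ∂(P' n)) atTop
      (𝓝 (∫ ω, averageProduct f g (μ ω) (fun i => Z (t i) ω) ∂P)) := by
  have hYs (n : ℕ+) (s : T) : Measurable (Y n s) := (hY n).comp measurable_prodMk_left
  intro m
  induction m with
  | zero =>
    intro k t f _ g hg
    simpa [averageProduct] using h.tendsto_integral t hg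
  | succ m ih =>
    intro k t f hf g hg
    have hgb := hg.exists_abs_le
    simp_rw [fun n => (hν n).integral_averageProduct (hYs n) hf hg.measurable hgb t]
    rw [hμ.integral_averageProduct hZ hf hg.measurable hgb t]
    obtain ⟨C, hC0, hC⟩ := exists_bound_averageProduct (fun j : Fin m => hf j.succ) hgb
    obtain ⟨D, hD⟩ := (hf 0).bounded
    -- Convergence is needed only for each fixed `s`, so the test functions need not be continuous
    -- in time.
    refine tendsto_integral_filter_of_dominated_convergence (fun _ => |D| * C)
      (.of_forall fun n => ?_) (.of_forall fun n => ae_of_all _ fun s => ?_)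
      (integrable_const _) (ae_of_all _ fun s => ?_)
    · simp_rw [averageProduct_cons]
      have hx : Measurable fun ω i => Y n (t i) ω := by fun_prop
      have hR := measurable_averageProduct (fun j : Fin m => hf j.succ) hg.measurable hx (ν n)
      have hF : Measurable fun q : T × Ω' n => f 0 (q.1, Y n q.1 q.2, fun i => Y n (t i) q.2) *
          averageProduct (fun j => f j.succ) g (ν n q.2) (fun i => Y n (t i) q.2) :=
        ((hf 0).measurable.comp (measurable_fst.prodMk
          ((hY n).prodMk (hx.comp measurable_snd)))).mul (hR.comp measurable_snd)
      exact hF.stronglyMeasurable.integral_prod_right'.aestronglyMeasurable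
    · refine (norm_integral_le_of_norm_le_const (C := |D| * C)
        (ae_of_all _ fun ω => ?_)).trans (by simp)
      rw [averageProduct_cons, Real.norm_eq_abs, abs_mul]
      exact mul_le_mul ((hD _).trans (le_abs_self _)) (hC _ _) (abs_nonneg _) (abs_nonneg _)
    · refine ih (Fin.cons s t) (fun j => (hf j.succ).comp_tail) ?_
      refine Continuous.mul ?_ (hg.comp (by unfold Fin.tail; fun_prop))
      exact ((hf 0).continuous s).comp
        (g := fun q => f 0 (s, q)) (f := fun x : Fin (k + 1) → X => (x 0, Fin.tail x))
        (by unfold Fin.tail; fun_prop)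

end Moments

/-! ### From moments to convergence in distribution -/

section Distribution

open ProbabilityTheory

theorem tendsto_of_forall_approx {ι : Type*} {l : Filter ι} {u : ι → ℝ} {a : ℝ}
    (h : ∀ ε > 0, ∃ v : ι → ℝ, ∃ b, Tendsto v l (𝓝 b) ∧ (∀ᶠ n in l, |v n - u n| ≤ ε) ∧
      |b - a| ≤ ε) : Tendsto u l (𝓝 a) := by
  rw [Metric.tendsto_nhds]
  intro ε hε
  obtain ⟨v, b, hv, hvu, hba⟩ := h (ε / 4) (by positivity)
  filter_upwards [hvu, Metric.tendsto_nhds.1 hv (ε / 4) (by positivity)] with n h1 h2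
  rw [Real.dist_eq] at h2 ⊢
  rw [abs_le] at h1 hba
  rw [abs_lt] at h2 ⊢
  constructor <;> linarith

theorem integrable_comp_of_dist_le {E Ω : Type*} [MeasurableSpace E] [MeasurableSpace Ω]
    {P : Measure Ω} [IsProbabilityMeasure P] {F : E → ℝ} (hF : Measurable F) {C : ℝ}
    (hC : ∀ x y, dist (F x) (F y) ≤ C) {B : Ω → E} (hB : AEMeasurable B P) :
    Integrable (fun ω => F (B ω)) P := by
  obtain ⟨ω₀⟩ := P.nonempty_of_neZero
  refine Integrable.of_bound (hF.comp_aemeasurable hB).aestronglyMeasurable (C + |F (B ω₀)|)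
    (ae_of_all _ fun ω => ?_)
  have h1 := hC (B ω) (B ω₀)
  rw [Real.dist_eq] at h1
  have h2 := abs_sub_abs_le_abs_sub (F (B ω)) (F (B ω₀))
  rw [Real.norm_eq_abs]
  linarith

theorem abs_integral_map_sub_le {E Ω : Type*} [PseudoMetricSpace E] [MeasurableSpace E]
    [OpensMeasurableSpace E] [MeasurableSpace Ω] {P : Measure Ω} [IsProbabilityMeasure P]
    {F : E → ℝ} {L : NNReal} (hL : LipschitzWith L F) {C : ℝ} (hC : ∀ x y, dist (F x) (F y) ≤ C)
    {A B : Ω → E} (hA : AEMeasurable A P) (hB : AEMeasurable B P) {ε : ℝ}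
    (h : ∀ᵐ ω ∂P, dist (A ω) (B ω) ≤ ε) :
    |∫ x, F x ∂(P.map A) - ∫ x, F x ∂(P.map B)| ≤ L * ε := by
  have hFm : Measurable F := hL.continuous.measurable
  rw [integral_map hA hFm.aestronglyMeasurable, integral_map hB hFm.aestronglyMeasurable,
    ← integral_sub (integrable_comp_of_dist_le hFm hC hA) (integrable_comp_of_dist_le hFm hC hB),
    ← Real.norm_eq_abs]
  refine (norm_integral_le_of_norm_le_const (C := L * ε) ?_).trans (by simp)
  filter_upwards [h] with ω hω
  rw [← dist_eq_norm]
  exact (hL.dist_le_mul _ _).trans (by gcongr)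

/-- Random variables that can be approximated uniformly by sequences converging in distribution
converge in distribution. -/
theorem tendstoInDistribution_of_forall_approx {ι E Ω : Type*} {Ω' : ι → Type*}
    [PseudoMetricSpace E] [MeasurableSpace E] [OpensMeasurableSpace E]
    [∀ n, MeasurableSpace (Ω' n)] [MeasurableSpace Ω] {l : Filter ι} [l.IsCountablyGenerated]
    {P' : ∀ n, Measure (Ω' n)} [∀ n, IsProbabilityMeasure (P' n)]
    {P : Measure Ω} [IsProbabilityMeasure P] {D : ∀ n, Ω' n → E} {D' : Ω → E}
    (hD : ∀ n, AEMeasurable (D n) (P' n)) (hD' : AEMeasurable D' P)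
    (h : ∀ ε > 0, ∃ A : ∀ n, Ω' n → E, ∃ A' : Ω → E, TendstoInDistribution A l A' P' P ∧
      (∀ᶠ n in l, ∀ ω, dist (A n ω) (D n ω) ≤ ε) ∧ ∀ᵐ ω ∂P, dist (A' ω) (D' ω) ≤ ε) :
    TendstoInDistribution D l D' P' P := by
  refine ⟨hD, hD', tendsto_iff_forall_lipschitz_integral_tendsto.2 ?_⟩
  rintro F ⟨C, hC⟩ ⟨L, hL⟩
  refine tendsto_of_forall_approx fun ε hε => ?_
  have hL0 : (0 : ℝ) ≤ L := L.2
  -- Dividing by `L + 1` instead of `L` covers `L = 0`.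
  obtain ⟨A, A', hA, hAD, hAD'⟩ := h (ε / (L + 1)) (by positivity)
  have hle : L * (ε / (L + 1)) ≤ ε := by
    rw [mul_div_assoc', div_le_iff₀ (by positivity)]
    nlinarith
  refine ⟨fun n => ∫ x, F x ∂((P' n).map (A n)), ∫ x, F x ∂(P.map A'),
    tendsto_iff_forall_lipschitz_integral_tendsto.1 hA.tendsto F ⟨C, hC⟩ ⟨L, hL⟩, ?_, ?_⟩
  · filter_upwards [hAD] with n hn
    exact (abs_integral_map_sub_le hL hC (hA.forall_aemeasurable n) (hD n) (ae_of_all _ hn)).trans hle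
  · exact (abs_integral_map_sub_le hL hC hA.aemeasurable_limit hD' hAD').trans hle

/-- Convergence in distribution only depends on the law of the limit. -/
theorem tendstoInDistribution_map_iff {ι E Ω Ω₀ : Type*} {Ω' : ι → Type*}
    [TopologicalSpace E] [MeasurableSpace E] [OpensMeasurableSpace E]
    [∀ n, MeasurableSpace (Ω' n)] [MeasurableSpace Ω] [MeasurableSpace Ω₀] {l : Filter ι}
    {P' : ∀ n, Measure (Ω' n)} [∀ n, IsProbabilityMeasure (P' n)]
    {P : Measure Ω} [IsProbabilityMeasure P]
    {D : ∀ n, Ω' n → E} {D' : Ω₀ → E} {φ : Ω → Ω₀} [IsProbabilityMeasure (P.map φ)]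
    (hφ : Measurable φ) (hD' : AEMeasurable D' (P.map φ)) :
    TendstoInDistribution D l D' P' (P.map φ) ↔
      TendstoInDistribution D l (fun ω => D' (φ ω)) P' P := by
  have e : (⟨(P.map φ).map D', Measure.isProbabilityMeasure_map hD'⟩ : ProbabilityMeasure E) =
      ⟨P.map fun ω => D' (φ ω),
        Measure.isProbabilityMeasure_map (hD'.comp_measurable hφ)⟩ :=
    Subtype.ext (AEMeasurable.map_map_of_aemeasurable hD' hφ.aemeasurable)
  exact ⟨fun h => ⟨h.forall_aemeasurable, hD'.comp_measurable hφ, e ▸ h.tendsto⟩,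
    fun h => ⟨h.forall_aemeasurable, hD', e.symm ▸ h.tendsto⟩⟩

/-- The continuous functions of `m` reals and of a point of a space `E` that are monomials in the
reals times a function of the point. -/
def monomialFunctions (m : ℕ) (E : Type*) [TopologicalSpace E] :
    Submonoid C((Fin m → ℝ) × E, ℝ) where
  carrier := {Φ | ∃ (L : List (Fin m)) (g : C(E, ℝ)), ∀ v, Φ v = (L.map v.1).prod * g v.2}
  one_mem' := ⟨[], 1, fun v => by simp⟩
  mul_mem' := by
    rintro Φ Ψ ⟨L, g, h⟩ ⟨L', g', h'⟩
    refine ⟨L ++ L', g * g', fun v => ?_⟩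
    simp only [ContinuousMap.mul_apply, h, h', List.map_append, List.prod_append]
    ring

theorem separatesPoints_adjoin_monomialFunctions (m : ℕ) (E : Type*) [TopologicalSpace E]
    [CompactSpace E] [T2Space E] :
    (Algebra.adjoin ℝ (monomialFunctions m E : Set C((Fin m → ℝ) × E, ℝ))).SeparatesPoints := by
  intro v w hvw
  by_cases h1 : v.1 = w.1
  · have h2 : v.2 ≠ w.2 := fun h2 => hvw (Prod.ext h1 h2)
    obtain ⟨g, hg0, hg1, -⟩ := exists_continuous_zero_one_of_isClosed
      (isClosed_singleton (x := v.2)) (isClosed_singleton (x := w.2)) (by simpa using h2)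
    refine ⟨_, ⟨⟨fun v => g v.2, by fun_prop⟩, Algebra.subset_adjoin ⟨[], g, fun v => ?_⟩, rfl⟩, ?_⟩
    · simp
    · have h0 : g v.2 = 0 := hg0 rfl
      have h1 : g w.2 = 1 := hg1 rfl
      simp [h0, h1]
  · obtain ⟨j, hj⟩ := Function.ne_iff.1 h1
    refine ⟨_, ⟨⟨fun v => v.1 j, by fun_prop⟩,
      Algebra.subset_adjoin ⟨[j], 1, fun v => ?_⟩, rfl⟩, hj⟩
    simp

section AverageVector

variable {T X Ω : Type*} [MeasurableSpace T] [MeasurableSpace X] [MeasurableSpace Ω] {m k : ℕ}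

/-- The averages of the functions `f j` against `ν`, together with the further values `x`. -/
noncomputable def averageVector (f : Fin m → T × X × (Fin k → X) → ℝ) (ν : Measure (T × X))
    (x : Fin k → X) : (Fin m → ℝ) × (Fin k → X) :=
  (fun j => ∫ p, f j (p.1, p.2, x) ∂ν, x)

variable [TopologicalSpace X] {f : Fin m → T × X × (Fin k → X) → ℝ}
  (hf : ∀ j, IsTestFunction (f j))

include hf

theorem measurable_averageVector {x : Ω → Fin k → X} (hx : Measurable x) (ν : Kernel Ω (T × X))
    [IsMarkovKernel ν] : Measurable fun ω => averageVector f (ν ω) (x ω) :=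
  (measurable_pi_lambda _ fun j => (hf j).measurable_integral hx ν).prodMk hx

theorem exists_isCompact_averageVector_mem [CompactSpace X] :
    ∃ K : Set ((Fin m → ℝ) × (Fin k → X)), IsCompact K ∧
      ∀ (ν : Measure (T × X)) [IsProbabilityMeasure ν] (x : Fin k → X),
        averageVector f ν x ∈ K := by
  choose C hC using fun j => (hf j).bounded
  refine ⟨(Set.univ.pi fun j => Set.Icc (-C j) (C j)) ×ˢ Set.univ,
    (isCompact_univ_pi fun j => isCompact_Icc).prod isCompact_univ,
    fun ν _ x => ⟨fun j _ => abs_le.1 ?_, trivial⟩⟩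
  rw [← Real.norm_eq_abs]
  exact (norm_integral_le_of_norm_le_const (C := C j) (ae_of_all _ fun p => hC j _)).trans
    (by simp)

variable [CompactSpace X] [SecondCountableTopology X] [BorelSpace X]

theorem integrable_averageVector (P : Measure Ω) [IsProbabilityMeasure P]
    {x : Ω → Fin k → X} (hx : Measurable x) (ν : Kernel Ω (T × X)) [IsMarkovKernel ν]
    {Φ : (Fin m → ℝ) × (Fin k → X) → ℝ} (hΦ : Continuous Φ) :
    Integrable (fun ω => Φ (averageVector f (ν ω) (x ω))) P := by
  obtain ⟨K, hK, hVK⟩ := exists_isCompact_averageVector_mem hf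
  obtain ⟨D, hD⟩ := hK.exists_bound_of_continuousOn hΦ.continuousOn
  exact Integrable.of_bound
    (hΦ.measurable.comp (measurable_averageVector hf hx ν)).aestronglyMeasurable D
    (ae_of_all _ fun ω => hD _ (hVK _ _))

theorem abs_integral_averageVector_sub_le {K : Set ((Fin m → ℝ) × (Fin k → X))}
    (hVK : ∀ (ν : Measure (T × X)) [IsProbabilityMeasure ν] (x : Fin k → X),
      averageVector f ν x ∈ K) (P : Measure Ω) [IsProbabilityMeasure P]
    {x : Ω → Fin k → X} (hx : Measurable x) (ν : Kernel Ω (T × X)) [IsMarkovKernel ν]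
    {Φ Ψ : (Fin m → ℝ) × (Fin k → X) → ℝ} (hΦ : Continuous Φ) (hΨ : Continuous Ψ) {ε : ℝ}
    (h : ∀ v ∈ K, ‖Ψ v - Φ v‖ ≤ ε) :
    |∫ ω, Ψ (averageVector f (ν ω) (x ω)) ∂P -
      ∫ v, Φ v ∂(P.map fun ω => averageVector f (ν ω) (x ω))| ≤ ε := by
  rw [integral_map (measurable_averageVector hf hx ν).aemeasurable
    hΦ.measurable.aestronglyMeasurable,
    ← integral_sub (integrable_averageVector hf P hx ν hΨ)
      (integrable_averageVector hf P hx ν hΦ), ← Real.norm_eq_abs]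
  exact (norm_integral_le_of_norm_le_const (C := ε)
    (ae_of_all _ fun ω => h _ (hVK _ _))).trans (by simp)

variable {Ω' : ℕ+ → Type*} [∀ n, MeasurableSpace (Ω' n)]
  {P' : ∀ n, Measure (Ω' n)} [∀ n, IsProbabilityMeasure (P' n)]
  {P : Measure Ω} [IsProbabilityMeasure P]
  {lam : Measure T} [IsProbabilityMeasure lam]
  {Y : ∀ n, T → Ω' n → X} {Z : T → Ω → X}
  {ν : ∀ n, Kernel (Ω' n) (T × X)} [∀ n, IsMarkovKernel (ν n)]
  {μ : Kernel Ω (T × X)} [IsMarkovKernel μ]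

/-- The monomial functions are closed under multiplication, so the algebra they generate is their
linear span. On a monomial the claim is the moment convergence, with test functions repeated along
the list of factors. -/
theorem tendsto_integral_averageVector (hY : ∀ n, Measurable (Function.uncurry (Y n)))
    (hZ : ∀ s, Measurable (Z s)) (hν : ∀ n, IsOccupationKernel lam (Y n) (P' n) (ν n))
    (hμ : IsOccupationKernel lam Z P μ) (h : TendstoFDD Y Z P' P) (t : Fin k → T)
    {Φ : C((Fin m → ℝ) × (Fin k → X), ℝ)} (hΦ : Φ ∈ Algebra.adjoin ℝ
      (monomialFunctions m (Fin k → X) : Set C((Fin m → ℝ) × (Fin k → X), ℝ))) :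
    Tendsto (fun n => ∫ ω, Φ (averageVector f (ν n ω) fun i => Y n (t i) ω) ∂(P' n)) atTop
      (𝓝 (∫ ω, Φ (averageVector f (μ ω) fun i => Z (t i) ω) ∂P)) := by
  have hYs (n : ℕ+) : Measurable fun ω i => Y n (t i) ω :=
    measurable_pi_lambda _ fun i => (hY n).comp measurable_prodMk_left
  have hZs : Measurable fun ω i => Z (t i) ω := by fun_prop
  rw [← Subalgebra.mem_toSubmodule, Algebra.adjoin_eq_span, Submonoid.closure_eq] at hΦ
  induction hΦ using Submodule.span_induction with
  | mem Φ hΦ =>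
    obtain ⟨L, g, hL⟩ := hΦ
    have := tendsto_integral_averageProduct hY hZ hν hμ h t (fun i => hf L[i.1]) g.continuous
    have hprod (ν : Measure (T × X)) (x : Fin k → X) :
        averageProduct (fun i : Fin L.length => f L[i.1]) g ν x = Φ (averageVector f ν x) := by
      rw [hL]
      exact congrArg (· * g x) (Fin.prod_univ_fun_getElem L (averageVector f ν x).1)
    simpa only [hprod] using this
  | zero => simp
  | add Φ Ψ _ _ hΦ hΨ =>
    simp only [ContinuousMap.add_apply]
    rw [integral_add (integrable_averageVector hf P hZs μ Φ.continuous)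
      (integrable_averageVector hf P hZs μ Ψ.continuous)]
    refine (hΦ.add hΨ).congr fun n => ?_
    rw [integral_add (integrable_averageVector hf (P' n) (hYs n) (ν n) Φ.continuous)
      (integrable_averageVector hf (P' n) (hYs n) (ν n) Ψ.continuous)]
  | smul a Φ _ hΦ =>
    simp only [ContinuousMap.smul_apply, smul_eq_mul, integral_const_mul]
    exact hΦ.const_mul a

/-- All the vectors lie in one compact set, on which Stone–Weierstrass approximates any bounded
continuous function uniformly by elements of the algebra. -/
theorem tendstoInDistribution_averageVector [T2Space X]
    (hY : ∀ n, Measurable (Function.uncurry (Y n)))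
    (hZ : ∀ s, Measurable (Z s)) (hν : ∀ n, IsOccupationKernel lam (Y n) (P' n) (ν n))
    (hμ : IsOccupationKernel lam Z P μ) (h : TendstoFDD Y Z P' P) (t : Fin k → T) :
    TendstoInDistribution (fun n ω => averageVector f (ν n ω) fun i => Y n (t i) ω) atTop
      (fun ω => averageVector f (μ ω) fun i => Z (t i) ω) P' P := by
  have hYs (n : ℕ+) : Measurable fun ω i => Y n (t i) ω :=
    measurable_pi_lambda _ fun i => (hY n).comp measurable_prodMk_left
  have hZs : Measurable fun ω i => Z (t i) ω := by fun_prop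
  refine ⟨fun n => (measurable_averageVector hf (hYs n) (ν n)).aemeasurable,
    (measurable_averageVector hf hZs μ).aemeasurable,
    ProbabilityMeasure.tendsto_iff_forall_integral_tendsto.2 fun Φ =>
      tendsto_of_forall_approx fun ε hε => ?_⟩
  obtain ⟨K, hK, hVK⟩ := exists_isCompact_averageVector_mem hf
  obtain ⟨Ψ, hΨA, hΨ⟩ :=
    ContinuousMap.exists_mem_subalgebra_near_continuous_of_isCompact_of_separatesPoints
      (separatesPoints_adjoin_monomialFunctions m (Fin k → X)) Φ.toContinuousMap hK hε
  exact ⟨_, _, tendsto_integral_averageVector hf hY hZ hν hμ h t hΨA,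
    .of_forall fun n => abs_integral_averageVector_sub_le hf hVK (P' n) (hYs n) (ν n)
      Φ.continuous Ψ.continuous fun v hv => (hΨ v hv).le,
    abs_integral_averageVector_sub_le hf hVK P hZs μ Φ.continuous Ψ.continuous
      fun v hv => (hΨ v hv).le⟩

end AverageVector

end Distribution

/-! ### Cells of side `1 / n` and the rescaled permutation -/

section Cells

variable {n : ℕ} [NeZero n]

theorem natCast_pos_of_neZero (n : ℕ) [NeZero n] : (0 : ℝ) < n :=
  Nat.cast_pos.mpr (Nat.pos_of_ne_zero (NeZero.ne n))

theorem cellIndex_le (x : I) : ((cellIndex n x : ℕ) : ℝ) ≤ n * x := by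
  have hx : (0 : ℝ) ≤ n * x := mul_nonneg (Nat.cast_nonneg n) x.2.1
  simp only [cellIndex]
  rcases Nat.eq_zero_or_pos ⌈(n : ℝ) * x⌉₊ with h | h
  · simpa [h] using hx
  · rw [Nat.cast_sub h]
    have := Nat.ceil_lt_add_one hx
    push_cast
    linarith

theorem cellIndex_lt {x : I} (hx : 0 < x) : ((cellIndex n x : ℕ) : ℝ) < n * x := by
  have hx : (0 : ℝ) < n * x := mul_pos (natCast_pos_of_neZero n) (by exact_mod_cast hx)
  simp only [cellIndex]
  rw [Nat.cast_sub (Nat.ceil_pos.2 hx)]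
  have := Nat.ceil_lt_add_one hx.le
  push_cast
  linarith

theorem le_cellIndex_add_one (x : I) : (n : ℝ) * x ≤ (cellIndex n x : ℕ) + 1 := by
  refine (Nat.le_ceil _).trans ?_
  simp only [cellIndex]
  exact_mod_cast le_tsub_add

theorem cellIndex_eq {x : I} {i : Fin n} (h : ((i : ℕ) : ℝ) < n * x)
    (h' : (n : ℝ) * x ≤ (i : ℕ) + 1) : cellIndex n x = i := by
  have : ⌈(n : ℝ) * x⌉₊ = (i : ℕ) + 1 := by
    rw [Nat.ceil_eq_iff (by omega)]
    simpa using ⟨h, h'⟩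
  ext
  simp [cellIndex, this]

theorem measurable_cellIndex : Measurable (cellIndex n) := by
  refine measurable_to_countable' fun i => ?_
  have h : Measurable fun x : I => ⌈(n : ℝ) * x⌉₊ - 1 :=
    (Measurable.of_discrete (f := fun k : ℕ => k - 1)).comp
      (Nat.measurable_ceil.comp (by fun_prop))
  convert h (measurableSet_singleton (i : ℕ)) using 1
  ext x
  simp [cellIndex, Fin.ext_iff]

theorem volume_cellIndex_preimage (i : Fin n) :
    (volume : Measure I).real (cellIndex n ⁻¹' {i}) = 1 / n := by
  have hn := natCast_pos_of_neZero n
  have hi : ((i : ℕ) : ℝ) + 1 ≤ n := by exact_mod_cast i.isLt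
  let a : I := ⟨(i : ℕ) / n, by positivity, by rw [div_le_one hn]; linarith⟩
  let b : I := ⟨((i : ℕ) + 1) / n, by positivity, by rwa [div_le_one hn]⟩
  -- The cell is only squeezed between the half-open and the closed interval, since the first cell
  -- also contains `0`.
  have hab : Set.Ioc a b ⊆ cellIndex n ⁻¹' {i} := by
    rintro x ⟨hax, hxb⟩
    have hax : ((i : ℕ) : ℝ) / n < x := hax
    have hxb : (x : ℝ) ≤ ((i : ℕ) + 1) / n := hxb
    rw [div_lt_iff₀ hn] at hax
    rw [le_div_iff₀ hn] at hxb
    exact cellIndex_eq (by linarith) (by linarith)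
  have hba : cellIndex n ⁻¹' {i} ⊆ Set.Icc a b := by
    rintro x rfl
    constructor
    · change ((cellIndex n x : ℕ) : ℝ) / n ≤ x
      rw [div_le_iff₀ hn, mul_comm]
      exact cellIndex_le x
    · change (x : ℝ) ≤ ((cellIndex n x : ℕ) + 1) / n
      rw [le_div_iff₀ hn, mul_comm]
      exact le_cellIndex_add_one x
  have hd : ((b : ℝ) - a) = 1 / n := by
    change ((i : ℕ) + 1 : ℝ) / n - (i : ℕ) / n = 1 / n
    ring
  have h1 := measureReal_mono (μ := (volume : Measure I)) hab
  have h2 := measureReal_mono (μ := (volume : Measure I)) hba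
  simp only [measureReal_def, unitInterval.volume_Ioc, unitInterval.volume_Icc, hd] at h1 h2
  rw [ENNReal.toReal_ofReal (by positivity)] at h1 h2
  exact le_antisymm h2 h1

theorem integral_cellIndex (h : Fin n → ℝ) :
    ∫ s : I, h (cellIndex n s) = (∑ i, h i) / n := by
  have _ : IsProbabilityMeasure ((volume : Measure I).map (cellIndex n)) :=
    Measure.isProbabilityMeasure_map measurable_cellIndex.aemeasurable
  rw [← integral_map (f := h) measurable_cellIndex.aemeasurable
    (Measurable.of_discrete).aestronglyMeasurable, integral_fintype (Integrable.of_finite),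
    Finset.sum_div]
  refine Finset.sum_congr rfl fun i _ => ?_
  rw [map_measureReal_apply measurable_cellIndex (measurableSet_singleton i),
    volume_cellIndex_preimage, smul_eq_mul]
  ring

/-- The right end point of a cell. -/
noncomputable def cellEnd (i : Fin n) : I :=
  ⟨((i : ℕ) + 1) / n, by
    have hn := natCast_pos_of_neZero n
    have h : ((i : ℕ) : ℝ) + 1 ≤ n := by exact_mod_cast i.isLt
    exact ⟨by positivity, (div_le_one hn).mpr h⟩⟩

theorem permProcess_eq_cellEnd (τ : Equiv.Perm (Fin n)) (t : I) :
    permProcess τ t = cellEnd (τ (cellIndex n t)) := rfl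

theorem coe_permProcess (τ : Equiv.Perm (Fin n)) (t : I) :
    (permProcess τ t : ℝ) = ((τ (cellIndex n t) : ℕ) + 1) / n := rfl

theorem measurable_permProcess (τ : Equiv.Perm (Fin n)) : Measurable (permProcess τ) :=
  (Measurable.of_discrete (f := fun i : Fin n => cellEnd (τ i))).comp measurable_cellIndex

theorem abs_permProcess_sub_le {τ : Equiv.Perm (Fin n)} {s y : I}
    (h : τ (cellIndex n s) = cellIndex n y) : |(y : ℝ) - permProcess τ s| ≤ 1 / n := by
  have hn := natCast_pos_of_neZero n
  have h1 := cellIndex_le (n := n) y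
  have h2 := le_cellIndex_add_one (n := n) y
  rw [coe_permProcess, h, show (y : ℝ) = n * y / n by field_simp, ← sub_div, abs_div,
    abs_of_pos hn]
  gcongr
  rw [abs_le]
  constructor <;> linarith

/-- A permutation merely reorders the values, so the second marginal of its graph may be computed
with the identity. -/
theorem integral_comp_permProcess_snd (τ : Equiv.Perm (Fin n)) (ψ : I → ℝ) :
    ∫ s, ψ (permProcess τ s) = ∫ s, ψ (permProcess (1 : Equiv.Perm (Fin n)) s) := by
  simp only [permProcess_eq_cellEnd]
  rw [integral_cellIndex fun i => ψ (cellEnd (τ i)),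
    integral_cellIndex fun i => ψ (cellEnd ((1 : Equiv.Perm (Fin n)) i)),
    Equiv.sum_comp τ fun i => ψ (cellEnd i)]
  rfl

end Cells

/-! ### Comparison of the permuton with the graph -/

section Permuton

variable {n : ℕ} [NeZero n]

theorem measurable_permutonDensity (τ : Equiv.Perm (Fin n)) : Measurable fun p : I × I =>
    if τ (cellIndex n p.1) = cellIndex n p.2 then (n : ENNReal) else 0 := by
  have h : Measurable fun q : Fin n × Fin n => if τ q.1 = q.2 then (n : ENNReal) else 0 :=
    .of_discrete
  exact h.comp ((measurable_cellIndex.comp measurable_fst).prodMk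
    (measurable_cellIndex.comp measurable_snd))

theorem integral_permutonOf (τ : Equiv.Perm (Fin n)) (f : C(I × I, ℝ)) :
    ∫ p, f p ∂(permutonOf τ) =
      ∫ s, ∫ y, (if τ (cellIndex n s) = cellIndex n y then (n : ℝ) else 0) * f (s, y) := by
  have hm := measurable_permutonDensity τ
  rw [permutonOf, integral_withDensity_eq_integral_toReal_smul hm
    (ae_of_all _ fun p => by split_ifs <;> simp)]
  obtain ⟨C, hC⟩ := f.continuous.exists_abs_le
  rw [Measure.volume_eq_prod, integral_prod]
  · simp [apply_ite ENNReal.toReal]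
  · refine Integrable.of_bound
      (hm.ennreal_toReal.mul f.continuous.measurable).aestronglyMeasurable (n * |C|)
      (ae_of_all _ fun p => ?_)
    rw [smul_eq_mul, norm_mul]
    refine mul_le_mul ?_ ((hC p).trans (le_abs_self C)) (norm_nonneg _) (Nat.cast_nonneg n)
    split_ifs <;> simp

/-- Each `d (s, ·)` is a probability density living where `f (s, ·)` is within `ε` of `f (s, g s)`,
so averaging against it moves the value by at most `ε`. -/
theorem abs_integral_mul_density_sub_le {d f : I × I → ℝ} {g : I → I} {M C ε : ℝ}
    (hd : Measurable d) (hd0 : ∀ p, 0 ≤ d p) (hdM : ∀ p, d p ≤ M) (hone : ∀ s, ∫ y, d (s, y) = 1)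
    (hf : Measurable f) (hC : ∀ p, |f p| ≤ C) (hg : Measurable g)
    (h : ∀ s y, d (s, y) ≠ 0 → |f (s, y) - f (s, g s)| ≤ ε) :
    |(∫ s, ∫ y, d (s, y) * f (s, y)) - ∫ s, f (s, g s)| ≤ ε := by
  have hb (p : I × I) : ‖d p * f p‖ ≤ M * C := by
    rw [norm_mul, Real.norm_of_nonneg (hd0 p)]
    exact mul_le_mul (hdM p) (hC p) (norm_nonneg _) ((hd0 p).trans (hdM p))
  have hi1 : Integrable fun s => ∫ y, d (s, y) * f (s, y) :=
    Integrable.of_bound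
      (hd.mul hf).stronglyMeasurable.integral_prod_right'.aestronglyMeasurable (M * C)
      (ae_of_all _ fun s => (norm_integral_le_of_norm_le_const
        (ae_of_all _ fun y => hb (s, y))).trans (by simp))
  have hi2 : Integrable fun s => f (s, g s) :=
    Integrable.of_bound (hf.comp (measurable_id.prodMk hg)).aestronglyMeasurable C
      (ae_of_all _ fun s => hC _)
  rw [← integral_sub hi1 hi2, ← Real.norm_eq_abs]
  refine (norm_integral_le_of_norm_le_const (C := ε) (ae_of_all _ fun s => ?_)).trans (by simp)
  have hdi : Integrable fun y => d (s, y) :=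
    Integrable.of_bound (hd.comp measurable_prodMk_left).aestronglyMeasurable M
      (ae_of_all _ fun y => by rw [Real.norm_of_nonneg (hd0 _)]; exact hdM _)
  have hmi : Integrable fun y => d (s, y) * f (s, y) :=
    Integrable.of_bound ((hd.mul hf).comp measurable_prodMk_left).aestronglyMeasurable (M * C)
      (ae_of_all _ fun y => hb (s, y))
  have e : f (s, g s) = ∫ y, d (s, y) * f (s, g s) := by
    rw [integral_mul_const, hone, one_mul]
  rw [e, ← integral_sub hmi (hdi.mul_const _)]
  refine (norm_integral_le_of_norm_le (hdi.mul_const ε) (ae_of_all _ fun y => ?_)).trans_eq ?_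
  · rw [← mul_sub, norm_mul, Real.norm_of_nonneg (hd0 _)]
    rcases eq_or_ne (d (s, y)) 0 with h0 | h0
    · simp [h0]
    · exact mul_le_mul_of_nonneg_left (h s y h0) (hd0 _)
  · rw [integral_mul_const, hone, one_mul]

/-- The graph of the rescaled permutation approximates its permuton. -/
theorem abs_integral_permutonOf_sub_le (τ : Equiv.Perm (Fin n)) (f : C(I × I, ℝ)) {ε : ℝ}
    (hf : ∀ s y y' : I, |(y : ℝ) - y'| ≤ 1 / n → |f (s, y) - f (s, y')| ≤ ε) :
    |∫ p, f p ∂(permutonOf τ) - ∫ s, f (s, permProcess τ s)| ≤ ε := by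
  obtain ⟨C, hC⟩ := f.continuous.exists_abs_le
  have hn := natCast_pos_of_neZero n
  rw [integral_permutonOf]
  refine abs_integral_mul_density_sub_le
    (d := fun p => if τ (cellIndex n p.1) = cellIndex n p.2 then (n : ℝ) else 0) (M := n)
    ?_ (fun p => ?_) (fun p => ?_) (fun s => ?_) f.continuous.measurable hC
    (measurable_permProcess τ) fun s y h => ?_
  · have h : Measurable fun q : Fin n × Fin n => if τ q.1 = q.2 then (n : ℝ) else 0 :=
      .of_discrete
    exact h.comp ((measurable_cellIndex.comp measurable_fst).prodMk
      (measurable_cellIndex.comp measurable_snd))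
  · split_ifs <;> positivity
  · split_ifs <;> simp
  · rw [integral_cellIndex fun j => if τ (cellIndex n s) = j then (n : ℝ) else 0]
    simp [hn.ne']
  · exact hf _ _ _ (abs_permProcess_sub_le (by simpa [hn.ne'] using h))

end Permuton

/-! ### Smoothing the indicator -/

section Ramp

/-- A continuous approximation of the indicator of `[0, ∞)` from above. -/
noncomputable def ramp (ε u : ℝ) : ℝ := max 0 (min 1 (1 + u / ε))

@[fun_prop]
theorem continuous_ramp (ε : ℝ) : Continuous (ramp ε) := by
  unfold ramp
  fun_prop

theorem ramp_nonneg (ε u : ℝ) : 0 ≤ ramp ε u := le_max_left _ _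

theorem ramp_le_one (ε u : ℝ) : ramp ε u ≤ 1 := max_le zero_le_one (min_le_left _ _)

theorem ramp_of_nonneg {ε u : ℝ} (hε : 0 < ε) (hu : 0 ≤ u) : ramp ε u = 1 := by
  have : 0 ≤ u / ε := by positivity
  rw [ramp, min_eq_left (by linarith), max_eq_right zero_le_one]

theorem ramp_of_le {ε u : ℝ} (hε : 0 < ε) (hu : u ≤ -ε) : ramp ε u = 0 := by
  have : u / ε ≤ -1 := by rw [div_le_iff₀ hε]; linarith
  rw [ramp, max_eq_left ((min_le_right _ _).trans (by linarith))]

/-- The ramp is at distance at most `1` from the indicator of `[0, ∞)`, and differs from it only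
on `(-ε, 0)`. -/
theorem abs_ramp_sub_le {ε : ℝ} (hε : 0 < ε) (x y : ℝ) :
    |ramp ε (x - y) - if y ≤ x then 1 else 0| ≤ if x < y ∧ y < x + ε then 1 else 0 := by
  by_cases h : y ≤ x
  · rw [ramp_of_nonneg hε (by linarith), if_pos h, if_neg (by intro h'; linarith)]
    simp
  · rw [if_neg h, sub_zero, abs_of_nonneg (ramp_nonneg _ _)]
    split_ifs with h'
    · exact ramp_le_one _ _
    · rw [ramp_of_le hε]
      push Not at h h'
      linarith [h' h]

end Ramp

/-! ### Degrees and distribution functions -/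

section Degree

variable {n : ℕ}

theorem permGraph_adj (τ : Equiv.Perm (Fin n)) (i j : Fin n) :
    (permGraph τ).Adj i j ↔ (j < i ∧ τ i < τ j) ∨ (i < j ∧ τ j < τ i) := by
  change (((i : ℕ) : ℤ) - ((j : ℕ) : ℤ)) * (((τ i : ℕ) : ℤ) - ((τ j : ℕ) : ℤ)) < 0 ↔ _
  rw [mul_neg_iff]
  simp only [Fin.lt_def]
  omega

/-- The degree of `i` in terms of the number of points to the lower left of `(i, τ i)`. -/
theorem degree_permGraph_add (τ : Equiv.Perm (Fin n)) (i : Fin n) :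
    (permGraph τ).degree i + 2 * (Finset.univ.filter fun j => j ≤ i ∧ τ j ≤ τ i).card =
      (i + 1) + (τ i + 1) := by
  have h1 : (Finset.univ.filter fun j : Fin n => j ≤ i).card = i + 1 := by
    rw [← Fin.card_Iic i]
    congr 1
    ext j
    simp
  have h2 : (Finset.univ.filter fun j : Fin n => τ j ≤ τ i).card = τ i + 1 := by
    rw [← Fin.card_Iic (τ i)]
    refine Finset.card_bij (fun j _ => τ j) (by simp) (fun _ _ _ _ h => τ.injective h) fun b hb => ?_
    exact ⟨τ.symm b, by simpa using hb, by simp⟩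
  -- The neighbours of `i` are the points to the upper left and to the lower right of `(i, τ i)`:
  -- each family is a half-plane count minus the lower left count.
  have h3 : (permGraph τ).degree i =
      (Finset.univ.filter fun j : Fin n => j ≤ i ∧ ¬ τ j ≤ τ i).card +
      (Finset.univ.filter fun j : Fin n => τ j ≤ τ i ∧ ¬ j ≤ i).card := by
    rw [← SimpleGraph.card_neighborFinset_eq_degree, ← Finset.card_union_of_disjoint]
    · congr 1
      ext j
      simp only [SimpleGraph.mem_neighborFinset, permGraph_adj, Finset.mem_union,
        Finset.mem_filter, Finset.mem_univ, true_and]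
      have hij : τ i = τ j ↔ i = j := τ.injective.eq_iff
      constructor
      · rintro (⟨h, h'⟩ | ⟨h, h'⟩)
        · exact Or.inl ⟨h.le, h'.not_ge⟩
        · exact Or.inr ⟨h'.le, h.not_ge⟩
      · rintro (⟨h, h'⟩ | ⟨h, h'⟩)
        · refine Or.inl ⟨lt_of_le_of_ne h ?_, not_le.1 h'⟩
          rintro rfl
          exact h' le_rfl
        · refine Or.inr ⟨not_le.1 h', lt_of_le_of_ne h ?_⟩
          intro e
          exact h' (hij.1 e.symm).ge
    · rw [Finset.disjoint_left]
      simp only [Finset.mem_filter, Finset.mem_univ, true_and]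
      tauto
  have h4 := Finset.card_filter_add_card_filter_not (s := Finset.univ.filter fun j : Fin n => j ≤ i)
    (fun j => τ j ≤ τ i)
  have h5 := Finset.card_filter_add_card_filter_not
    (s := Finset.univ.filter fun j : Fin n => τ j ≤ τ i) (fun j => j ≤ i)
  simp only [Finset.filter_filter] at h4 h5
  have h6 : (Finset.univ.filter fun j : Fin n => τ j ≤ τ i ∧ j ≤ i) =
      Finset.univ.filter fun j : Fin n => j ≤ i ∧ τ j ≤ τ i := by
    simp only [and_comm]
  rw [h6] at h5
  omega

theorem card_filter_lt_lt_le (a : Fin n) {δ : ℝ} (hδ : 0 ≤ δ) :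
    ((Finset.univ.filter fun k : Fin n => (a : ℝ) < k ∧ (k : ℝ) < a + δ).card : ℝ) ≤ δ := by
  refine le_trans ?_ (Nat.floor_le hδ)
  have h : (Finset.univ.filter fun k : Fin n => (a : ℝ) < k ∧ (k : ℝ) < a + δ).card ≤
      (Finset.Ioc (a : ℕ) (a + ⌊δ⌋₊)).card := by
    refine Finset.card_le_card_of_injOn (fun k => (k : ℕ)) (fun k hk => ?_)
      (fun _ _ _ _ h => Fin.ext h)
    simp only [Finset.coe_filter, Finset.mem_univ, true_and, Set.mem_ofPred_eq] at hk
    have h1 : (a : ℕ) < k := by exact_mod_cast hk.1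
    have h2 : (k : ℕ) - (a : ℕ) ≤ ⌊δ⌋₊ := by
      refine Nat.le_floor ?_
      rw [Nat.cast_sub h1.le]
      linarith
    simp only [Finset.coe_Ioc, Set.mem_Ioc]
    omega
  simpa using h

variable [NeZero n]

theorem degreeProcess_eq (τ : Equiv.Perm (Fin n)) (t : I) :
    degreeProcess τ t = ((cellIndex n t : ℕ) + 1) / n + permProcess τ t - 2 * ∫ s : I,
      if cellIndex n s ≤ cellIndex n t ∧ τ (cellIndex n s) ≤ τ (cellIndex n t)
        then (1 : ℝ) else 0 := by
  have hn := natCast_pos_of_neZero n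
  have h := congrArg (Nat.cast (R := ℝ)) (degree_permGraph_add τ (cellIndex n t))
  push_cast at h
  rw [integral_cellIndex fun j =>
    if j ≤ cellIndex n t ∧ τ j ≤ τ (cellIndex n t) then (1 : ℝ) else 0, Finset.sum_boole,
    degreeProcess, coe_permProcess]
  field_simp
  linarith

/-- Since `τ` is injective, at most `ε n` indices have their value in a window of length `ε n`. -/
theorem integral_ramp_error_le (τ : Equiv.Perm (Fin n)) (t : I) {ε : ℝ} (hε : 0 < ε) :
    ∫ s : I, (if (permProcess τ t : ℝ) < permProcess τ s ∧
      (permProcess τ s : ℝ) < permProcess τ t + ε then (1 : ℝ) else 0) ≤ ε := by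
  have hn := natCast_pos_of_neZero n
  have h := card_filter_lt_lt_le (τ (cellIndex n t)) (δ := ε * n) (by positivity)
  have e (s : I) : (if (permProcess τ t : ℝ) < permProcess τ s ∧
      (permProcess τ s : ℝ) < permProcess τ t + ε then (1 : ℝ) else 0) =
      if ((τ (cellIndex n t) : ℕ) : ℝ) < (τ (cellIndex n s) : ℕ) ∧
        ((τ (cellIndex n s) : ℕ) : ℝ) < (τ (cellIndex n t) : ℕ) + ε * n then 1 else 0 := by
    refine if_congr (and_congr ?_ ?_) rfl rfl
    · rw [coe_permProcess, coe_permProcess, div_lt_div_iff_of_pos_right hn]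
      constructor <;> intro <;> linarith
    · rw [coe_permProcess, coe_permProcess, div_add' _ _ _ hn.ne', div_lt_div_iff_of_pos_right hn]
      constructor <;> intro <;> linarith
  simp only [e]
  rw [integral_cellIndex fun j => if ((τ (cellIndex n t) : ℕ) : ℝ) < (τ j : ℕ) ∧
        ((τ j : ℕ) : ℝ) < (τ (cellIndex n t) : ℕ) + ε * n then (1 : ℝ) else 0,
    Equiv.sum_comp τ fun k : Fin n => if ((τ (cellIndex n t) : ℕ) : ℝ) < (k : ℕ) ∧
        ((k : ℕ) : ℝ) < (τ (cellIndex n t) : ℕ) + ε * n then (1 : ℝ) else 0,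
    Finset.sum_boole, div_le_iff₀ hn]
  exact h

/-- The degree process in terms of the smoothed distribution function of the rescaled
permutation. -/
theorem abs_degreeProcess_sub_le (τ : Equiv.Perm (Fin n)) {t : I} (ht : 0 < t) {ε : ℝ}
    (hε : 0 < ε) :
    |(t + permProcess τ t - 2 * ∫ s : I,
      if s ≤ t then ramp ε (permProcess τ t - permProcess τ s) else 0) - degreeProcess τ t| ≤
      3 / n + 2 * ε := by
  have hn := natCast_pos_of_neZero n
  let e1 : I → ℝ := fun s => if cellIndex n s = cellIndex n t then 1 else 0
  let e2 : I → ℝ := fun s => if (permProcess τ t : ℝ) < permProcess τ s ∧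
      (permProcess τ s : ℝ) < permProcess τ t + ε then (1 : ℝ) else 0
  let u : I → ℝ := fun s => if s ≤ t then ramp ε (permProcess τ t - permProcess τ s) else 0
  let v : I → ℝ := fun s => if cellIndex n s ≤ cellIndex n t ∧
    τ (cellIndex n s) ≤ τ (cellIndex n t) then (1 : ℝ) else 0
  have hp := measurable_permProcess τ
  have hc := measurable_cellIndex (n := n)
  have hi {w : I → ℝ} (hw : Measurable w) (hb : ∀ s, |w s| ≤ 1) : Integrable w :=
    Integrable.of_bound hw.aestronglyMeasurable 1 (ae_of_all _ hb)
  have hu : Integrable u := by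
    refine hi (Measurable.ite measurableSet_Iic (by fun_prop) measurable_const) fun s => ?_
    simp only [u]
    split_ifs
    · rw [abs_of_nonneg (ramp_nonneg _ _)]
      exact ramp_le_one _ _
    · simp
  have hv : Integrable v := by
    refine hi ((Measurable.of_discrete (f := fun j : Fin n => if j ≤ cellIndex n t ∧
      τ j ≤ τ (cellIndex n t) then (1 : ℝ) else 0)).comp hc) fun s => ?_
    simp only [v]
    split_ifs <;> simp
  have he1 : Integrable e1 := by
    refine hi ((Measurable.of_discrete (f := fun j : Fin n =>
      if j = cellIndex n t then (1 : ℝ) else 0)).comp hc) fun s => ?_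
    simp only [e1]
    split_ifs <;> simp
  have he2 : Integrable e2 := by
    have hp' : Measurable fun s => (permProcess τ s : ℝ) := measurable_subtype_coe.comp hp
    refine hi (Measurable.ite ?_ measurable_const measurable_const) fun s => ?_
    · exact (measurableSet_lt measurable_const hp').inter (measurableSet_lt hp' measurable_const)
    · simp only [e2]
      split_ifs <;> simp
  -- If `s` and `t` lie in different cells, their order agrees with that of the cells and only the
  -- ramp can err. In the cell of `t` the orders may disagree, and the trivial bound `1` is used.
  have hle (s : I) : ‖u s - v s‖ ≤ e1 s + e2 s := by
    have h2 : 0 ≤ e2 s := by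
      simp only [e2]
      split_ifs <;> simp
    have h1 : 0 ≤ e1 s := by
      simp only [e1]
      split_ifs <;> simp
    rw [Real.norm_eq_abs]
    rcases lt_trichotomy (cellIndex n s) (cellIndex n t) with h | h | h
    · have hst : s ≤ t := by
        have a1 := le_cellIndex_add_one (n := n) s
        have a2 := cellIndex_lt (n := n) ht
        have a3 : ((cellIndex n s : ℕ) : ℝ) + 1 ≤ (cellIndex n t : ℕ) := by exact_mod_cast h
        have a4 : (s : ℝ) < t := lt_of_mul_lt_mul_left (by linarith : (n : ℝ) * s < n * t) hn.le
        exact a4.le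
      have hτ : τ (cellIndex n s) ≤ τ (cellIndex n t) ↔
          (permProcess τ s : ℝ) ≤ permProcess τ t := by
        rw [coe_permProcess, coe_permProcess, div_le_div_iff_of_pos_right hn,
          add_le_add_iff_right, Nat.cast_le, Fin.le_def]
      have := abs_ramp_sub_le hε (permProcess τ t) (permProcess τ s)
      simp only [u, v, if_pos hst, h.le, true_and, hτ]
      exact this.trans (le_add_of_nonneg_left h1)
    · have : |u s - v s| ≤ 1 := by
        have := ramp_nonneg ε (permProcess τ t - permProcess τ s)
        have := ramp_le_one ε (permProcess τ t - permProcess τ s)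
        simp only [u, v]
        split_ifs <;> rw [abs_le] <;> constructor <;> linarith
      have h1 : e1 s = 1 := if_pos h
      linarith
    · have hst : ¬ s ≤ t := by
        have a1 := le_cellIndex_add_one (n := n) t
        have a2 := cellIndex_le (n := n) s
        have a3 : ((cellIndex n t : ℕ) : ℝ) + 1 ≤ (cellIndex n s : ℕ) := by exact_mod_cast h
        have hs : 0 < s := by
          rw [unitInterval.pos_iff_ne_zero]
          rintro rfl
          simp only [Set.Icc.coe_zero, mul_zero] at a2
          linarith [Nat.cast_nonneg (α := ℝ) (cellIndex n t : ℕ)]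
        have a4 := cellIndex_lt (n := n) hs
        have a5 : (t : ℝ) < s := lt_of_mul_lt_mul_left (by linarith : (n : ℝ) * t < n * s) hn.le
        exact not_le.2 a5
      simp only [u, v, if_neg hst, h.not_ge, false_and, if_false, sub_zero, abs_zero]
      positivity
  have hE1 : ∫ s, e1 s = 1 / n := by
    simp only [e1]
    rw [integral_cellIndex fun j => if j = cellIndex n t then (1 : ℝ) else 0]
    simp
  have hE2 : ∫ s, e2 s ≤ ε := integral_ramp_error_le τ t hε
  have hkey : |(∫ s, u s) - ∫ s, v s| ≤ 1 / n + ε := by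
    rw [← integral_sub hu hv, ← Real.norm_eq_abs]
    refine (norm_integral_le_of_norm_le (he1.add he2) (ae_of_all _ hle)).trans ?_
    simp only [Pi.add_apply]
    rw [integral_add he1 he2, hE1]
    linarith
  have ht' : |(t : ℝ) - ((cellIndex n t : ℕ) + 1) / n| ≤ 1 / n :=
    abs_permProcess_sub_le (τ := (1 : Equiv.Perm (Fin n))) (s := t) (y := t) rfl
  rw [degreeProcess_eq]
  change |(t + permProcess τ t - 2 * ∫ s, u s) - (((cellIndex n t : ℕ) + 1) / n +
    permProcess τ t - 2 * ∫ s, v s)| ≤ _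
  -- Twice the `1 / n` from the cell of `t`, plus `1 / n` from rounding `t` up to the end of its
  -- cell.
  have e3 : (3 : ℝ) / n = 1 / n + 2 * (1 / n) := by ring
  rw [abs_le] at hkey ht' ⊢
  constructor <;> linarith [hkey.1, hkey.2, ht'.1, ht'.2]

theorem IsPermuton.isProbabilityMeasure {μ : Measure (I × I)} (hμ : IsPermuton μ) :
    IsProbabilityMeasure μ where
  measure_univ := by
    rw [← Set.preimage_univ (f := Prod.fst), ← Measure.map_apply measurable_fst .univ, hμ.map_fst,
      measure_univ]

/-- The distribution function of a permuton and its smoothing. -/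
theorem IsPermuton.abs_integral_ramp_sub_distFun_le {μ : Measure (I × I)} (hμ : IsPermuton μ)
    (t x : I) {ε : ℝ} (hε : 0 < ε) :
    |∫ p, (if p.1 ≤ t then ramp ε (x - p.2) else 0) ∂μ - distFun μ t x| ≤ ε := by
  have _ := hμ.isProbabilityMeasure
  let e : I → ℝ := fun y => if (x : ℝ) < y ∧ (y : ℝ) < x + ε then 1 else 0
  have hS : MeasurableSet {y : I | (x : ℝ) < y ∧ (y : ℝ) < x + ε} :=
    (measurableSet_lt measurable_const measurable_subtype_coe).inter
      (measurableSet_lt measurable_subtype_coe measurable_const)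
  have he : Measurable e := Measurable.ite hS measurable_const measurable_const
  have hei (y : I) : |e y| ≤ 1 := by
    simp only [e]
    split_ifs <;> simp
  have hE : ∫ p, e p.2 ∂μ ≤ ε := by
    have h1 : e = {y : I | (x : ℝ) < y ∧ (y : ℝ) < x + ε}.indicator 1 := by
      ext y
      simp [e, Set.indicator_apply]
    rw [← integral_map (f := e) measurable_snd.aemeasurable he.aestronglyMeasurable, hμ.map_snd,
      h1, integral_indicator_one hS, measureReal_def, unitInterval.volume_apply]
    refine ENNReal.toReal_le_of_le_ofReal hε.le
      ((measure_mono (t := Set.Ioo (x : ℝ) (x + ε)) ?_).trans (by simp))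
    rintro _ ⟨y, hy, rfl⟩
    exact hy
  have hA : MeasurableSet (Set.Iic t ×ˢ Set.Iic x) := measurableSet_Iic.prod measurableSet_Iic
  have hi1 : Integrable (fun p : I × I => if p.1 ≤ t then ramp ε (x - p.2) else 0) μ := by
    refine Integrable.of_bound (Measurable.ite (measurable_fst measurableSet_Iic) (by fun_prop)
      measurable_const).aestronglyMeasurable 1 (ae_of_all _ fun p => ?_)
    split_ifs
    · rw [Real.norm_of_nonneg (ramp_nonneg _ _)]
      exact ramp_le_one _ _
    · simp
  have hi2 : Integrable ((Set.Iic t ×ˢ Set.Iic x).indicator (1 : I × I → ℝ)) μ :=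
    (integrable_const (1 : ℝ)).indicator hA
  have hi3 : Integrable (fun p : I × I => e p.2) μ :=
    Integrable.of_bound (he.comp measurable_snd).aestronglyMeasurable 1
      (ae_of_all _ fun p => hei p.2)
  rw [distFun, ← integral_indicator_one hA, ← integral_sub hi1 hi2, ← Real.norm_eq_abs]
  refine (norm_integral_le_of_norm_le hi3 (ae_of_all _ fun p => ?_)).trans hE
  have h0 : 0 ≤ e p.2 := by
    simp only [e]
    split_ifs <;> simp
  have := abs_ramp_sub_le hε x p.2
  by_cases hp : p.1 ≤ t
  · have h2 : (Set.Iic t ×ˢ Set.Iic x).indicator (1 : I × I → ℝ) p =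
        if (p.2 : ℝ) ≤ x then 1 else 0 := by
      simp [Set.indicator_apply, Prod.le_def, hp]
    rw [if_pos hp, h2]
    exact this
  · have h2 : (Set.Iic t ×ˢ Set.Iic x).indicator (1 : I × I → ℝ) p = 0 := by
      simp [Prod.le_def, hp]
    rw [if_neg hp, h2]
    simpa using h0

end Degree

/-! ### Occupation kernels of the approximating processes and of the limit -/

section OccupationKernels

open ProbabilityTheory

theorem measurable_map_of_measurable_uncurry {S Ω E : Type*} [MeasurableSpace S]
    [MeasurableSpace Ω] [MeasurableSpace E] (P : Measure Ω) [SFinite P] {G : S → Ω → E}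
    (hG : Measurable (Function.uncurry G)) : Measurable fun s => P.map (G s) := by
  refine Measure.measurable_of_measurable_coe _ fun B hB => ?_
  have hs (s : S) : Measurable (G s) := hG.comp measurable_prodMk_left
  have e : (fun s => P.map (G s) B) = fun s => P (Prod.mk s ⁻¹' (Function.uncurry G ⁻¹' B)) :=
    funext fun s => Measure.map_apply (hs s) hB
  rw [e]
  exact measurable_measure_prodMk_left (hG hB)

/-- The occupation kernel of a jointly measurable process. -/
theorem exists_isOccupationKernel_of_measurable {T X Ω : Type*} [MeasurableSpace T]
    [MeasurableSpace X] [MeasurableSpace Ω] (lam : Measure T) [IsProbabilityMeasure lam]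
    (P : Measure Ω) [IsProbabilityMeasure P] {Y : T → Ω → X}
    (hY : Measurable (Function.uncurry Y)) :
    ∃ ν : Kernel Ω (T × X), IsMarkovKernel ν ∧ (∀ ω, ν ω = lam.map fun s => (s, Y s ω)) ∧
      IsOccupationKernel lam Y P ν := by
  have hG : Measurable (Function.uncurry fun (ω : Ω) (s : T) => (s, Y s ω)) :=
    measurable_snd.prodMk (hY.comp measurable_swap)
  have hs (ω : Ω) : Measurable fun s => (s, Y s ω) := hG.comp measurable_prodMk_left
  refine ⟨⟨_, measurable_map_of_measurable_uncurry lam hG⟩,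
    ⟨fun ω => Measure.isProbabilityMeasure_map (hs ω).aemeasurable⟩, fun ω => rfl,
    fun F hF ⟨C, hC⟩ => ?_⟩
  have hF' : Measurable fun q : Ω × T => F (q.1, (q.2, Y q.2 q.1)) :=
    hF.comp (measurable_fst.prodMk hG)
  rw [← integral_integral_swap (f := fun ω s => F (ω, (s, Y s ω)))
    (Integrable.of_bound hF'.aestronglyMeasurable C (ae_of_all _ fun q => hC _))]
  congr 1 with ω
  exact integral_map (hs ω).aemeasurable (hF.comp measurable_prodMk_left).aestronglyMeasurable

variable {T X Ω : Type*} [TopologicalSpace X] [SecondCountableTopology X]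
  [MeasurableSpace X] [BorelSpace X] [MeasurableSpace Ω]
  {Ω' : ℕ+ → Type*} [∀ n, MeasurableSpace (Ω' n)]
  {P' : ∀ n, Measure (Ω' n)} [∀ n, IsProbabilityMeasure (P' n)]
  {P : Measure Ω} [IsProbabilityMeasure P]

/-- The limit of finite-dimensional distributions can be realized on the space of paths. -/
theorem TendstoFDD.exists_path {Y : ∀ n, T → Ω' n → X} {Z : T → Ω → X}
    (h : TendstoFDD Y Z P' P) :
    ∃ φ : Ω → T → X, Measurable φ ∧ (∀ t, (fun ω => φ ω t) =ᵐ[P] Z t) ∧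
      ∃ _ : IsProbabilityMeasure (P.map φ), TendstoFDD Y (fun t (z : T → X) => z t) P' (P.map φ) := by
  have hZ (t : T) : AEMeasurable (Z t) P :=
    (aemeasurable_pi_iff.1 (h 1 fun _ => t).aemeasurable_limit) 0
  -- A measurable version is chosen for each time separately; this does not change the
  -- finite-dimensional distributions.
  have hφ : Measurable fun ω t => (hZ t).mk _ ω :=
    measurable_pi_lambda _ fun t => (hZ t).measurable_mk
  have hQ := Measure.isProbabilityMeasure_map (μ := P) hφ.aemeasurable
  refine ⟨_, hφ, fun t => (hZ t).ae_eq_mk.symm, hQ, fun k t => ?_⟩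
  refine (tendstoInDistribution_map_iff hφ ?_).2 ?_
  · exact (measurable_pi_lambda _ fun i => measurable_pi_apply (t i)).aemeasurable
  · refine (h k t).congr (fun n => .rfl) ?_
    filter_upwards [ae_all_iff.2 fun i => (hZ (t i)).ae_eq_mk] with ω hω
    exact funext hω

/-- For the approximating processes joint measurability makes the laws measurable in `s`; this
passes to pointwise weak limits, so nothing is asked of the limiting paths. -/
theorem TendstoFDD.measurable_map_path_prodMk [MeasurableSpace T]
    [TopologicalSpace.PseudoMetrizableSpace X]
    {Y : ∀ n, T → Ω' n → X}
    {Q : Measure (T → X)} [IsProbabilityMeasure Q]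
    (h : TendstoFDD Y (fun t (z : T → X) => z t) P' Q)
    (hY : ∀ n, Measurable (Function.uncurry (Y n))) :
    Measurable fun s => Q.map fun z => (z, z s) := by
  refine _root_.measurable_map_path_prodMk fun J => ?_
  have hYm (n : ℕ+) : Measurable (Function.uncurry fun (s : T) (ω : Ω' n) =>
      ((fun i => Y n i ω : J → X), Y n s ω)) :=
    (measurable_pi_lambda _ fun i => ((hY n).comp measurable_prodMk_left).comp
      measurable_snd).prodMk (hY n)
  have hYs (n : ℕ+) (s : T) : Measurable fun ω => ((fun i => Y n i ω : J → X), Y n s ω) :=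
    (hYm n).comp measurable_prodMk_left
  have hQs (s : T) : Measurable fun z : T → X => (J.restrict z, z s) := by fun_prop
  refine measurable_of_tendsto_probabilityMeasure (l := atTop)
    (ν := fun n s => ⟨(P' n).map fun ω => ((fun i => Y n i ω : J → X), Y n s ω),
      Measure.isProbabilityMeasure_map (hYs n s).aemeasurable⟩)
    (ν' := fun s => ⟨Q.map fun z => (J.restrict z, z s),
      Measure.isProbabilityMeasure_map (hQs s).aemeasurable⟩)
    (fun n => measurable_map_of_measurable_uncurry (P' n) (hYm n)) fun s => ?_
  -- Coordinate `0` carries the time `s` and the others enumerate `J`; `s` may also belong to `J`,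
  -- since tuples of times may have repetitions.
  let g : (Fin (J.card + 1) → X) → (J → X) × X := fun x => (fun i => x (J.equivFin i).succ, x 0)
  have hg : Continuous g := by fun_prop
  have key : TendstoInDistribution (fun n ω => ((fun i => Y n i ω : J → X), Y n s ω)) atTop
      (fun z => (J.restrict z, z s)) P' Q :=
    ((h _ (Fin.cons s fun i => (J.equivFin.symm i : T))).continuous_comp hg).congr
      (fun n => ae_of_all _ fun ω => by simp [g])
      (ae_of_all _ fun z => by simp [g, Finset.restrict_def])
  exact key.tendsto

end OccupationKernels

/-! ### Construction of the random permuton -/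

section RandomPermuton

open ProbabilityTheory

/-- The processes are indexed by `(0, 1]` while the measures live on the closed square; the missing
time `0` is a null set. -/
theorem map_coe_comap_coe_Ioc :
    ((volume : Measure I).comap ((↑) : Set.Ioc (0 : I) 1 → I)).map ((↑) : Set.Ioc (0 : I) 1 → I) =
      volume := by
  rw [(MeasurableEmbedding.subtype_coe measurableSet_Ioc).map_comap, Subtype.range_coe]
  refine Measure.restrict_eq_self_of_ae_mem ?_
  have h : ∀ᵐ x : I, x ≠ 0 := by simp [ae_iff]
  filter_upwards [h] with x hx
  exact ⟨unitInterval.pos_iff_ne_zero.2 hx, unitInterval.le_one'⟩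

instance : IsProbabilityMeasure
    ((volume : Measure I).comap ((↑) : Set.Ioc (0 : I) 1 → I)) where
  measure_univ := by
    rw [← Set.preimage_univ (f := ((↑) : Set.Ioc (0 : I) 1 → I)),
      ← Measure.map_apply measurable_subtype_coe .univ, map_coe_comap_coe_Ioc, measure_univ]

/-- The uniform measure on the graph of a rescaled permutation. -/
noncomputable def graphMeasure {n : ℕ} [NeZero n] (τ : Equiv.Perm (Fin n)) : Measure (I × I) :=
  volume.map fun s => (s, permProcess τ s)

theorem measurable_prodMk_permProcess {n : ℕ} [NeZero n] (τ : Equiv.Perm (Fin n)) :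
    Measurable fun s => (s, permProcess τ s) :=
  measurable_id.prodMk (measurable_permProcess τ)

theorem integral_graphMeasure {n : ℕ} [NeZero n] (τ : Equiv.Perm (Fin n)) {f : I × I → ℝ}
    (hf : Measurable f) : ∫ p, f p ∂(graphMeasure τ) = ∫ s, f (s, permProcess τ s) :=
  integral_map (measurable_prodMk_permProcess τ).aemeasurable hf.aestronglyMeasurable

theorem averageVector_map {T T' X : Type*} [MeasurableSpace T] [MeasurableSpace T']
    [MeasurableSpace X] [TopologicalSpace X] {m k : ℕ} {f : Fin m → T' × X × (Fin k → X) → ℝ}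
    (hf : ∀ j, IsTestFunction (f j)) {g : T → T'} (hg : Measurable g) (ν : Measure (T × X))
    (x : Fin k → X) : averageVector f (ν.map (Prod.map g id)) x =
      averageVector (fun j p => f j (g p.1, p.2)) ν x := by
  refine Prod.ext (funext fun j => ?_) rfl
  have h : Measurable fun p : T' × X => f j (p.1, p.2, x) := (hf j).measurable.comp (by fun_prop)
  exact integral_map (hg.prodMap measurable_id).aemeasurable h.aestronglyMeasurable

theorem IsTestFunction.comp_left {T T' X : Type*} [MeasurableSpace T] [MeasurableSpace T']
    [MeasurableSpace X] [TopologicalSpace X] {k : ℕ} {f : T' × X × (Fin k → X) → ℝ}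
    (hf : IsTestFunction f) {g : T → T'} (hg : Measurable g) :
    IsTestFunction fun p : T × X × (Fin k → X) => f (g p.1, p.2) where
  measurable := hf.measurable.comp (by fun_prop)
  continuous s := hf.continuous (g s)
  bounded := hf.bounded.imp fun _ h _ => h _

/-- A random variable that is the limit in distribution of random variables converging uniformly
to a constant is almost surely equal to that constant. -/
theorem ae_eq_const_of_tendstoInDistribution {ι Ω : Type*} {Ω' : ι → Type*}
    [∀ n, MeasurableSpace (Ω' n)] [MeasurableSpace Ω] {l : Filter ι} [l.IsCountablyGenerated]
    [l.NeBot] {P' : ∀ n, Measure (Ω' n)} [∀ n, IsProbabilityMeasure (P' n)]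
    {P : Measure Ω} [IsProbabilityMeasure P] {D : ∀ n, Ω' n → ℝ} {D' : Ω → ℝ}
    (h : TendstoInDistribution D l D' P' P) {c : ℝ}
    (hc : ∀ ε > 0, ∀ᶠ n in l, ∀ ω, |c - D n ω| ≤ ε) : ∀ᵐ ω ∂P, D' ω = c := by
  have hconst : TendstoInDistribution D l (fun _ : Ω => c) P' P := by
    refine tendstoInDistribution_of_forall_approx h.forall_aemeasurable aemeasurable_const
      fun ε hε => ⟨fun _ _ => c, fun _ => c, ⟨fun n => aemeasurable_const, aemeasurable_const, ?_⟩,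
        hc ε hε, ae_of_all _ fun _ => by simp [hε.le]⟩
    have e (n : ι) : (P' n).map (fun _ => c) = P.map fun _ => c := by simp
    simp only [e]
    exact tendsto_const_nhds
  have hlaw := tendstoInDistribution_unique D h hconst
  have h0 : P (D' ⁻¹' {c}ᶜ) = 0 := by
    rw [← Measure.map_apply_of_aemeasurable h.aemeasurable_limit (measurableSet_singleton c).compl,
      hlaw, Measure.map_apply measurable_const (measurableSet_singleton c).compl]
    simp
  exact h0

/-- Probability measures on a compact metrizable space that give the same integrals to a dense
sequence of continuous functions are equal. -/
theorem eq_of_forall_integral_denseSeq_eq {E : Type*} [TopologicalSpace E] [CompactSpace E]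
    [TopologicalSpace.MetrizableSpace E] [SecondCountableTopology E]
    [MeasurableSpace E] [BorelSpace E]
    {μ ν : Measure E} [IsProbabilityMeasure μ] [IsProbabilityMeasure ν]
    (h : ∀ i, ∫ x, TopologicalSpace.denseSeq C(E, ℝ) i x ∂μ =
      ∫ x, TopologicalSpace.denseSeq C(E, ℝ) i x ∂ν) : μ = ν := by
  have hi (μ : Measure E) [IsProbabilityMeasure μ] (f : C(E, ℝ)) : Integrable f μ :=
    Integrable.of_bound f.continuous.measurable.aestronglyMeasurable ‖f‖
      (ae_of_all _ fun x => f.norm_coe_le_norm x)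
  have hcont (μ : Measure E) [IsProbabilityMeasure μ] :
      Continuous fun f : C(E, ℝ) => ∫ x, f x ∂μ := by
    refine (LipschitzWith.of_dist_le_mul (K := 1) fun f g => ?_).continuous
    rw [dist_eq_norm, dist_eq_norm, ← integral_sub (hi μ f) (hi μ g)]
    refine (norm_integral_le_of_norm_le_const (C := ‖f - g‖)
      (ae_of_all _ fun x => (f - g).norm_coe_le_norm x)).trans (by simp)
  refine ext_of_forall_integral_eq_of_IsFiniteMeasure fun f => ?_
  refine (TopologicalSpace.denseRange_denseSeq C(E, ℝ)).induction_on
    (p := fun g : C(E, ℝ) => ∫ x, g x ∂μ = ∫ x, g x ∂ν) f.toContinuousMap ?_ h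
  exact isClosed_eq (hcont μ) (hcont ν)

theorem isPermuton_volume : IsPermuton (volume : Measure (I × I)) where
  map_fst := by simp [Measure.volume_eq_prod, Measure.map_fst_prod]
  map_snd := by simp [Measure.volume_eq_prod, Measure.map_snd_prod]

theorem integral_graphMeasure_fst {n : ℕ} [NeZero n] (τ : Equiv.Perm (Fin n)) (φ : C(I, ℝ)) :
    ∫ p, φ p.1 ∂(graphMeasure τ) = ∫ x, φ x :=
  integral_graphMeasure τ (f := fun p => φ p.1) (φ.continuous.measurable.comp measurable_fst)

theorem tendsto_integral_graphMeasure_snd (φ : C(I, ℝ)) :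
    ∀ ε > 0, ∀ᶠ n : ℕ+ in atTop, ∀ τ : Equiv.Perm (Fin n),
      |(∫ x, φ x) - ∫ p, φ p.2 ∂(graphMeasure τ)| ≤ ε := by
  have hlim : Tendsto (fun n : ℕ+ => ∫ s, φ (permProcess (1 : Equiv.Perm (Fin n)) s)) atTop
      (𝓝 (∫ s, φ s)) := by
    refine tendsto_integral_filter_of_dominated_convergence (fun _ => ‖φ‖)
      (.of_forall fun n => (φ.continuous.measurable.comp
        (measurable_permProcess _)).aestronglyMeasurable)
      (.of_forall fun n => ae_of_all _ fun s => φ.norm_coe_le_norm _) (integrable_const _)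
      (ae_of_all _ fun s => (φ.continuous.tendsto s).comp ?_)
    rw [tendsto_iff_dist_tendsto_zero]
    refine squeeze_zero (g := fun n : ℕ+ => (1 : ℝ) / n) (fun _ => dist_nonneg) (fun n => ?_)
      (tendsto_one_div_atTop_nhds_zero_nat.comp tendsto_PNat_val_atTop_atTop)
    rw [dist_comm]
    exact abs_permProcess_sub_le rfl
  intro ε hε
  filter_upwards [Metric.tendsto_nhds.1 hlim ε hε] with n hn τ
  rw [integral_graphMeasure τ (f := fun p => φ p.2) (φ.continuous.measurable.comp measurable_snd),
    integral_comp_permProcess_snd, abs_sub_comm]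
  exact hn.le

/-- Integrals against the marginals of the graph measures converge uniformly to Lebesgue integrals,
so their limits in distribution are almost surely these constants. A countable dense family of test
functions gives one exceptional null set. -/
theorem ae_isPermuton_of_tendstoInDistribution {Ω : Type*} {Ω' : ℕ+ → Type*}
    [∀ n, MeasurableSpace (Ω' n)] [MeasurableSpace Ω]
    {P' : ∀ n, Measure (Ω' n)} [∀ n, IsProbabilityMeasure (P' n)]
    {P : Measure Ω} [IsProbabilityMeasure P] {π : ∀ n : ℕ+, Ω' n → Equiv.Perm (Fin n)}
    {μ : Ω → Measure (I × I)} (hμ : ∀ ω, IsProbabilityMeasure (μ ω))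
    (h : ∀ f : C(I × I, ℝ), TendstoInDistribution (fun n ω => ∫ p, f p ∂(graphMeasure (π n ω)))
      atTop (fun ω => ∫ p, f p ∂(μ ω)) P' P) : ∀ᵐ ω ∂P, IsPermuton (μ ω) := by
  have h1 : ∀ᵐ ω ∂P, ∀ i, ∫ p, TopologicalSpace.denseSeq C(I, ℝ) i p.1 ∂(μ ω) =
      ∫ x, TopologicalSpace.denseSeq C(I, ℝ) i x := by
    rw [ae_all_iff]
    intro i
    refine ae_eq_const_of_tendstoInDistribution
      (h ((TopologicalSpace.denseSeq C(I, ℝ) i).comp ⟨Prod.fst, continuous_fst⟩))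
      fun ε hε => .of_forall fun n ω => ?_
    have := integral_graphMeasure_fst (π n ω) (TopologicalSpace.denseSeq C(I, ℝ) i)
    simp [this, hε.le]
  have h2 : ∀ᵐ ω ∂P, ∀ i, ∫ p, TopologicalSpace.denseSeq C(I, ℝ) i p.2 ∂(μ ω) =
      ∫ x, TopologicalSpace.denseSeq C(I, ℝ) i x := by
    rw [ae_all_iff]
    intro i
    refine ae_eq_const_of_tendstoInDistribution
      (h ((TopologicalSpace.denseSeq C(I, ℝ) i).comp ⟨Prod.snd, continuous_snd⟩)) fun ε hε => ?_
    filter_upwards [tendsto_integral_graphMeasure_snd (TopologicalSpace.denseSeq C(I, ℝ) i) ε hε]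
      with n hn ω
    exact hn (π n ω)
  filter_upwards [h1, h2] with ω hω1 hω2
  have _ := hμ ω
  have _ : IsProbabilityMeasure ((μ ω).map Prod.fst) :=
    Measure.isProbabilityMeasure_map measurable_fst.aemeasurable
  have _ : IsProbabilityMeasure ((μ ω).map Prod.snd) :=
    Measure.isProbabilityMeasure_map measurable_snd.aemeasurable
  constructor
  · refine eq_of_forall_integral_denseSeq_eq fun i => ?_
    rw [integral_map measurable_fst.aemeasurable
      (ContinuousMap.continuous _).measurable.aestronglyMeasurable, hω1 i]
  · refine eq_of_forall_integral_denseSeq_eq fun i => ?_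
    rw [integral_map measurable_snd.aemeasurable
      (ContinuousMap.continuous _).measurable.aestronglyMeasurable, hω2 i]

theorem measurable_comp_perm {n : ℕ} {Ω E : Type*} [MeasurableSpace Ω] [MeasurableSpace E]
    {π : Ω → Equiv.Perm (Fin n)} (hπ : ∀ τ, MeasurableSet {ω | π ω = τ})
    (G : Equiv.Perm (Fin n) → E) : Measurable fun ω => G (π ω) := by
  let _ : MeasurableSpace (Equiv.Perm (Fin n)) := ⊤
  have h : Measurable π := measurable_to_countable' fun τ => hπ τ
  exact (measurable_from_top (f := G)).comp h

theorem measurable_permProcess_prod {n : ℕ} [NeZero n] {Ω : Type*} [MeasurableSpace Ω]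
    {π : Ω → Equiv.Perm (Fin n)} (hπ : ∀ τ, MeasurableSet {ω | π ω = τ}) :
    Measurable fun q : I × Ω => permProcess (π q.2) q.1 := by
  let _ : MeasurableSpace (Equiv.Perm (Fin n)) := ⊤
  have h : Measurable fun q : Equiv.Perm (Fin n) × Fin n => cellEnd (q.1 q.2) :=
    measurable_from_prod_countable_right fun τ => .of_discrete
  have hπ' : Measurable π := measurable_comp_perm hπ id
  have h' : Measurable fun q : I × Ω => (π q.2, cellIndex n q.1) :=
    (hπ'.comp measurable_snd).prodMk (measurable_cellIndex.comp measurable_fst)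
  exact (h.comp h' :)

variable {Ω : Type*} [MeasurableSpace Ω] {Ω' : ℕ+ → Type*} [∀ n, MeasurableSpace (Ω' n)]
  {P' : ∀ n, Measure (Ω' n)} [∀ n, IsProbabilityMeasure (P' n)]
  {P : Measure Ω} [IsProbabilityMeasure P] {π : ∀ n : ℕ+, Ω' n → Equiv.Perm (Fin n)}
  {Z : Set.Ioc (0 : I) 1 → Ω → I}

/-- The random permuton associated with the limit of the permutation processes. -/
theorem exists_random_permuton
    (hπ : ∀ (n : ℕ+) (τ : Equiv.Perm (Fin n)), MeasurableSet {ω | π n ω = τ})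
    (hZ : TendstoFDD (fun n (t : Set.Ioc (0 : I) 1) ω => permProcess (π n ω) t) Z P' P) :
    ∃ μ : Ω → Measure (I × I), Measurable μ ∧ (∀ ω, IsPermuton (μ ω)) ∧
      ∀ {m k : ℕ} (t : Fin k → Set.Ioc (0 : I) 1) {f : Fin m → I × I × (Fin k → I) → ℝ},
        (∀ j, IsTestFunction (f j)) → TendstoInDistribution
          (fun n ω => averageVector f (graphMeasure (π n ω)) fun i => permProcess (π n ω) (t i))
          atTop (fun ω => averageVector f (μ ω) fun i => Z (t i) ω) P' P := by
  let lam := (volume : Measure I).comap ((↑) : Set.Ioc (0 : I) 1 → I)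
  let _ : Nonempty (Set.Ioc (0 : I) 1) := ⟨⟨1, zero_lt_one, le_rfl⟩⟩
  let _ : StandardBorelSpace (Set.Ioc (0 : I) 1) := measurableSet_Ioc.standardBorel
  let Y : ∀ n : ℕ+, Set.Ioc (0 : I) 1 → Ω' n → I := fun n t ω => permProcess (π n ω) t
  have hY (n : ℕ+) : Measurable (Function.uncurry (Y n)) := by
    have h : Measurable fun q : Set.Ioc (0 : I) 1 × Ω' n => ((q.1 : I), q.2) := by fun_prop
    rw [Function.uncurry_def]
    exact ((measurable_permProcess_prod (hπ n)).comp h :)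
  obtain ⟨φ, hφ, hφZ, _, hQ⟩ := hZ.exists_path
  obtain ⟨μ, hμm, hμ⟩ := exists_isOccupationKernel lam (hQ.measurable_map_path_prodMk hY)
  choose ν hνm hν hνocc using fun n => exists_isOccupationKernel_of_measurable lam (P' n) (hY n)
  have hcoe : Measurable ((↑) : Set.Ioc (0 : I) 1 → I) := measurable_subtype_coe
  have hmap : Measurable (Prod.map ((↑) : Set.Ioc (0 : I) 1 → I) (id : I → I)) :=
    hcoe.prodMap measurable_id
  let M : (Set.Ioc (0 : I) 1 → I) → Measure (I × I) := fun z => (μ z).map (Prod.map (↑) id)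
  have hM : Measurable M := (Measure.measurable_map _ hmap).comp μ.measurable
  have hMp (z : Set.Ioc (0 : I) 1 → I) : IsProbabilityMeasure (M z) :=
    Measure.isProbabilityMeasure_map hmap.aemeasurable
  have hνg (n : ℕ+) (ω : Ω' n) : graphMeasure (π n ω) = (ν n ω).map (Prod.map (↑) id) := by
    have hs : Measurable fun s => (s, Y n s ω) := measurable_id.prodMk
      ((measurable_permProcess (π n ω)).comp hcoe :)
    rw [hν, Measure.map_map hmap hs, graphMeasure, ← map_coe_comap_coe_Ioc,
      Measure.map_map (measurable_prodMk_permProcess _) hcoe]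
    rfl
  have hconv {m k : ℕ} (t : Fin k → Set.Ioc (0 : I) 1) {f : Fin m → I × I × (Fin k → I) → ℝ}
      (hf : ∀ j, IsTestFunction (f j)) : TendstoInDistribution
        (fun n ω => averageVector f (graphMeasure (π n ω)) fun i => permProcess (π n ω) (t i))
        atTop (fun z => averageVector f (M z) fun i => z (t i)) P' (P.map φ) := by
    simp only [hνg, M, averageVector_map hf hcoe]
    exact tendstoInDistribution_averageVector (fun j => (hf j).comp_left hcoe) hY
      (fun s => measurable_pi_apply s) hνocc hμ hQ t
  have hperm : ∀ᵐ z ∂(P.map φ), IsPermuton (M z) := by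
    refine ae_isPermuton_of_tendstoInDistribution (P' := P') (π := π) hMp fun f => ?_
    have hf : IsTestFunction fun p : I × I × (Fin 0 → I) => f (p.1, p.2.1) :=
      ⟨f.continuous.measurable.comp (by fun_prop), fun s => by fun_prop,
        f.continuous.exists_abs_le.imp fun _ h p => h _⟩
    exact (hconv Fin.elim0 fun _ : Fin 1 => hf).continuous_comp (g := fun v => v.1 0) (by fun_prop)
  -- Changing the kernel on a null set makes every value a permuton.
  obtain ⟨M', hM', hMr, hMM⟩ := hM.aemeasurable.exists_ae_eq_range_subset
    (t := {ν | IsPermuton ν}) hperm ⟨_, isPermuton_volume⟩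
  refine ⟨fun ω => M' (φ ω), hM'.comp hφ, fun ω => hMr ⟨_, rfl⟩, fun t f hf => ?_⟩
  refine ((tendstoInDistribution_map_iff hφ (hconv t hf).aemeasurable_limit).1 (hconv t hf)).congr
    (fun n => .rfl) ?_
  filter_upwards [ae_of_ae_map hφ.aemeasurable hMM, ae_all_iff.2 fun i => hφZ (t i)] with ω h1 h2
  rw [h1]
  exact congrArg _ (funext h2)

end RandomPermuton

/-! ### Proof of the main theorem -/

section MainTheorem

open ProbabilityTheory

theorem measurable_distFun {Ω : Type*} [MeasurableSpace Ω] {μ : Ω → Measure (I × I)}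
    (hμ : Measurable μ) (hμp : ∀ ω, IsProbabilityMeasure (μ ω)) {z : Ω → I} (hz : Measurable z)
    (t : I) : Measurable fun ω => distFun (μ ω) t (z ω) := by
  let κ : Kernel Ω (I × I) := ⟨μ, hμ⟩
  have _ : IsMarkovKernel κ := ⟨hμp⟩
  have h1 : Measurable fun q : Ω × (I × I) => q.2.2 := by fun_prop
  have h2 : Measurable fun q : Ω × (I × I) => z q.1 := hz.comp measurable_fst
  have hS : MeasurableSet {q : Ω × (I × I) | q.2.1 ≤ t ∧ q.2.2 ≤ z q.1} :=
    (measurable_snd.fst measurableSet_Iic).inter (measurableSet_le h1 h2 :)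
  exact (Kernel.measurable_kernel_prodMk_left (κ := κ) hS).ennreal_toReal

theorem eventually_abs_integral_permutonOf_sub_le (f : C(I × I, ℝ)) :
    ∀ ε > 0, ∀ᶠ n : ℕ+ in atTop, ∀ τ : Equiv.Perm (Fin n),
      |∫ p, f p ∂(graphMeasure τ) - ∫ p, f p ∂(permutonOf τ)| ≤ ε := by
  intro ε hε
  obtain ⟨δ, hδ, hf⟩ := Metric.uniformContinuous_iff.1
    (CompactSpace.uniformContinuous_of_continuous f.continuous) ε hε
  have hlim : Tendsto (fun n : ℕ+ => (1 : ℝ) / n) atTop (𝓝 0) :=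
    tendsto_one_div_atTop_nhds_zero_nat.comp tendsto_PNat_val_atTop_atTop
  filter_upwards [hlim.eventually_lt_const hδ] with n hn τ
  rw [integral_graphMeasure τ f.continuous.measurable, abs_sub_comm]
  refine abs_integral_permutonOf_sub_le τ f fun s y y' h => ?_
  refine (hf (a := (s, y)) (b := (s, y')) ?_).le
  rw [Prod.dist_eq, dist_self, max_eq_right dist_nonneg]
  exact (h.trans_lt hn :)

/-- The sharp cutoff in time is harmless because test functions need continuity only in the values.
The dependence on the value at the `i`-th fixed time is what allows the distribution function to be
evaluated at a random point. -/
theorem isTestFunction_ramp {k : ℕ} (t : I) (i : Fin k) (ε : ℝ) :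
    IsTestFunction fun p : I × I × (Fin k → I) =>
      if p.1 ≤ t then ramp ε (p.2.2 i - p.2.1) else 0 where
  measurable := Measurable.ite (measurable_fst measurableSet_Iic)
    ((continuous_ramp ε).measurable.comp (by fun_prop)) measurable_const
  continuous s := by
    dsimp only
    split_ifs
    · exact (continuous_ramp ε).comp (by fun_prop)
    · exact continuous_const
  bounded := by
    refine ⟨1, fun p => ?_⟩
    split_ifs
    · rw [abs_of_nonneg (ramp_nonneg _ _)]
      exact ramp_le_one _ _
    · simp

end MainTheorem

theorem mainTheorem1
    {Ω' : ℕ+ → Type*} [∀ n, MeasurableSpace (Ω' n)]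
    (P' : ∀ n, Measure (Ω' n)) [∀ n, IsProbabilityMeasure (P' n)]
    (π : ∀ n : ℕ+, Ω' n → Equiv.Perm (Fin n))
    (hπ : ∀ (n : ℕ+) (τ : Equiv.Perm (Fin n)), MeasurableSet {ω | π n ω = τ})
    {Ω : Type*} [MeasurableSpace Ω] (P : Measure Ω) [IsProbabilityMeasure P]
    (Z : Set.Ioc (0 : I) 1 → Ω → I)
    (hZ : TendstoFDD (fun n (t : Set.Ioc (0 : I) 1) ω => permProcess (π n ω) t) Z P' P) :
    ∃ μ : Ω → Measure (I × I), Measurable μ ∧ (∀ ω, IsPermuton (μ ω)) ∧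
      TendstoRandomMeasure (fun n ω => permutonOf (π n ω)) μ P' P ∧
      TendstoJointly (fun n ω => permutonOf (π n ω)) (fun n (t : Set.Ioc (0 : I) 1) ω => permProcess (π n ω) t)
        μ Z P' P ∧
      TendstoFDD (fun n (t : Set.Ioc (0 : I) 1) ω => degreeProcess (π n ω) t)
        (fun t ω => (((t : I) : ℝ) + (Z t ω : ℝ) - 2 * distFun (μ ω) t (Z t ω))) P' P := by
  obtain ⟨μ, hμm, hμ, hconv⟩ := exists_random_permuton hπ hZ
  have hZm (t : Set.Ioc (0 : I) 1) : AEMeasurable (Z t) P :=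
    (aemeasurable_pi_iff.1 (hZ 1 fun _ => t).aemeasurable_limit) 0
  have hjoint : TendstoJointly (fun n ω => permutonOf (π n ω))
      (fun n (t : Set.Ioc (0 : I) 1) ω => permProcess (π n ω) t) μ Z P' P := by
    intro m k f t
    have hf (j : Fin m) : IsTestFunction fun p : I × I × (Fin k → I) => f j (p.1, p.2.1) :=
      ⟨(f j).continuous.measurable.comp (by fun_prop), fun s => by fun_prop,
        (f j).continuous.exists_abs_le.imp fun _ h p => h _⟩
    -- Graph measures approximate the permutons uniformly in the permutation, and the limit needs no
    -- approximation.
    refine tendstoInDistribution_of_forall_approx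
      (fun n => (measurable_comp_perm (hπ n) fun τ =>
        ((fun j => ∫ p, f j p ∂(permutonOf τ) : Fin m → ℝ),
          (fun i => permProcess τ (t i) : Fin k → I))).aemeasurable)
      (hconv t hf).aemeasurable_limit fun ε hε => ⟨_, _, hconv t hf, ?_, ?_⟩
    · filter_upwards [eventually_all.2 fun j =>
        eventually_abs_integral_permutonOf_sub_le (f j) ε hε] with n hn ω
      refine max_le ((dist_pi_le_iff hε.le).2 fun j => hn j (π n ω)) ?_
      simp [averageVector, hε.le]
    · exact ae_of_all _ fun ω => (dist_self _).trans_le hε.le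
  refine ⟨μ, hμm, hμ, fun f => ?_, hjoint, fun k t => ?_⟩
  · exact (hjoint 1 0 (fun _ => f) Fin.elim0).continuous_comp (g := fun v => v.1 0) (by fun_prop)
  · have hlim : Tendsto (fun n : ℕ+ => (3 : ℝ) / n) atTop (𝓝 0) :=
      (tendsto_const_div_atTop_nhds_zero_nat 3).comp tendsto_PNat_val_atTop_atTop
    refine tendstoInDistribution_of_forall_approx
      (fun n => (measurable_comp_perm (hπ n) fun τ i => degreeProcess τ (t i)).aemeasurable)
      (aemeasurable_pi_iff.2 fun i => ?_) fun ε hε => ?_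
    · have hD : Measurable fun ω => distFun (μ ω) (t i) ((hZm (t i)).mk _ ω) :=
        measurable_distFun hμm (fun ω => (hμ ω).isProbabilityMeasure) (hZm (t i)).measurable_mk _
      have hz : Measurable fun ω => ((hZm (t i)).mk _ ω : ℝ) :=
        measurable_subtype_coe.comp (hZm (t i)).measurable_mk
      refine ⟨_, (hz.const_add ((t i : I) : ℝ)).sub (hD.const_mul 2), ?_⟩
      filter_upwards [(hZm (t i)).ae_eq_mk] with ω hω
      rw [hω]
      rfl
    · have hg : Continuous fun (v : (Fin k → ℝ) × (Fin k → I)) (i : Fin k) =>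
          ((t i : I) : ℝ) + v.2 i - 2 * v.1 i := by fun_prop
      -- The ramp of width `ε / 4` costs `2 * (ε / 4)`, both along the sequence and in the limit;
      -- the other half of `ε` absorbs `3 / n`.
      refine ⟨_, _, (hconv t fun j => isTestFunction_ramp (t j : I) j (ε / 4)).continuous_comp hg,
        ?_, ae_of_all _ fun ω => (dist_pi_le_iff hε.le).2 fun i => ?_⟩
      · filter_upwards [hlim.eventually_lt_const (half_pos hε)] with n hn ω
        refine (dist_pi_le_iff hε.le).2 fun i => ?_
        have h := abs_degreeProcess_sub_le (π n ω) (t i).2.1 (ε := ε / 4) (by positivity)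
        have e : ∫ p, (if p.1 ≤ (t i : I) then
            ramp (ε / 4) (permProcess (π n ω) (t i) - p.2) else 0) ∂(graphMeasure (π n ω)) = _ :=
          integral_graphMeasure (π n ω) (Measurable.ite (measurable_fst measurableSet_Iic)
            ((continuous_ramp _).measurable.comp (by fun_prop)) measurable_const)
        rw [← e] at h
        have h' : (3 : ℝ) / (n : ℕ) + 2 * (ε / 4) ≤ ε := by linarith
        exact (h.trans h' :)
      · have h := (hμ ω).abs_integral_ramp_sub_distFun_le (t i) (Z (t i) ω) (ε := ε / 4)
          (by positivity)
        rw [Real.dist_eq]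
        simp only [Function.comp_apply, averageVector]
        rw [abs_le] at h ⊢
        constructor <;> linarith [h.1, h.2]
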